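/- **Setting.** Let $\alpha\in(0,1/2]$, $0\le\theta_0<\theta_1\le1$ and $\varepsilon=\theta_1-\theta_0$. A bag contains infinitely many distributions $i=0,1,2,\dots$, drawn independently; each is *heavy* with probability $\alpha$ and *light* otherwise. Sampling distribution $i$ repeatedly gives $X_{i,1},X_{i,2},\dots$; given its kind, these are independent, take values in $[0,1]$ and have mean $\theta_1$ if $i$ is heavy and $\theta_0$ if $i$ is light. **Subroutine $\mathcal A(\alpha_0,\varepsilon_0,\delta)$.** Put $n=\lceil 2\log(9)/\alpha_0\rceil$, $m=\lceil 64\varepsilon_0^{-2}\log(14n/\delta)\rceil$, $A=-8\varepsilon_0^{-1}\log 21$, $B=8\varepsilon_0^{-1}\log(14n/\delta)$, $k_1=5$, $k_2=\lceil 8\varepsilon_0^{-2}\log(2k_1/\min\{\delta/8,\,m^{-1}\varepsilon_0^{-2}\})\rceil$. Draw $k_1$ fresh distributions, sample each $k_2$ times, let $\widehat\theta_0$ be the smallest of their $k_1$ empirical means and $\widehat\gamma=\widehat\theta_0+\varepsilon_0/2$. Then, for up to $n$ further fresh distributions, one after the other: sample distribution $i$ for $j=1,\dots,m$; as soon as $\sum_{s\le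 j}(X_{i,s}-\widehat\gamma)>B$, declare $i$ heavy, output $i$ and stop; as soon as the sum is $<A$, discard $i$ and go to the next distribution (also after $m$ samples without a decision). If no distribution has been declared heavy, output null. **Algorithm.** Given $\delta$ only: for $\ell=1,2,\dots$ put $\gamma_\ell=2^\ell$ and $\delta_\ell=\delta/(2\ell^3)$, and for $k=0,\dots,\ell$ run $\mathcal A(\alpha_k,\varepsilon_k,\delta_\ell)$ with $\alpha_k=2^k/\gamma_\ell$ and $\varepsilon_k=\sqrt{1/(2\alpha_k\gamma_\ell)}$, each time on fresh distributions; stop at the first output that is not null and return it. **Theorem.** There is an absolute constant $c>0$ such that for all $\alpha,\theta_0,\theta_1$ as above and every $\delta\in(0,1)$, the algorithm run with $\delta$ (and without knowledge of $\alpha,\theta_0,\theta_1$) returns a heavy distribution with probability at least $1-\delta$, and the expected total number of samples it takes is at most $$c\,\frac{\log_2\frac{1}{\alpha\varepsilon^2}}{\alpha\varepsilon^2}\Big(\alpha\log_2\frac{1}{\varepsilon^2}+\log\log_2\frac{1}{\alpha\varepsilon^2}+\log\frac{2}{\delta}\Big).$$ If moreover $\delta\le 1/2$, it is at most $$c\,\frac{\log_2\frac{1}{\alpha\varepsilon^2}}{\alpha\varepsilon^2}\Big(\alpha\log_2\frac{1}{\varepsilon^2}+\log\log_2\frac{1}{\alpha\varepsilon^2}+\log\frac{1}{\delta}\Big).$$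 -/

import Mathlib

namespace MostBiasedCoin

noncomputable section

open MeasureTheory ProbabilityTheory

/-- The bag of distributions. Distribution `i` is heavy when `ξ i = true`, and `X i j` is its
`j`-th sample (indices start at `0`). The distributions are drawn independently, each is heavy
with probability `α`; given its kind, the samples of a distribution are independent, take values
in `[0, 1]` and are unbiased estimators of the mean, `θ₁` for a heavy and `θ₀` for a light one.
In particular the samples may be i.i.d. from a fixed heavy or a fixed light law. -/
structure IsBag {Ω : Type*} [MeasurableSpace Ω] (P : Measure Ω) (α θ₀ θ₁ : ℝ)
    (ξ : ℕ → Ω → Bool) (X : ℕ → ℕ → Ω → ℝ) : Prop where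
  measurable_kind : ∀ i, Measurable (ξ i)
  measurable_sample : ∀ i j, Measurable (X i j)
  sample_mem : ∀ i j, ∀ᵐ ω ∂P, X i j ω ∈ Set.Icc (0 : ℝ) 1
  prob_heavy : ∀ i, P.real (ξ i ⁻¹' {true}) = α
  indep_draws : iIndepFun (fun (i : ℕ) (ω : Ω) => (ξ i ω, fun j : ℕ => X i j ω)) P
  indep_samples : ∀ (i : ℕ) (b : Bool),
    iIndepFun (fun (j : ℕ) (ω : Ω) => X i j ω) (ProbabilityTheory.cond P (ξ i ⁻¹' {b}))
  mean_heavy : ∀ i j, ∫ ω, X i j ω ∂(ProbabilityTheory.cond P (ξ i ⁻¹' {true})) = θ₁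
  mean_light : ∀ i j, ∫ ω, X i j ω ∂(ProbabilityTheory.cond P (ξ i ⁻¹' {false})) = θ₀

/-- State of a procedure: the distribution declared heavy so far (`none` is `null`), the index of
the next distribution that has not been drawn, and the number of samples taken so far. -/
structure State where
  output : Option ℕ
  nextArm : ℕ
  samples : ℕ

/-- The sequential test of one distribution with sample sequence `x`: `testArm A B γ x r j S`
takes at most `r` further samples, after `j` samples with `∑ (x k - γ) = S`. It returns whether
the distribution was declared heavy, and the number of samples taken from it. -/
def testArm (A B γ : ℝ) (x : ℕ → ℝ) : ℕ → ℕ → ℝ → Bool × ℕ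
  | 0, j, _ => (false, j)
  | r + 1, j, S =>
    if S + (x j - γ) > B then (true, j + 1)
    else if S + (x j - γ) < A then (false, j + 1)
    else testArm A B γ x r (j + 1) (S + (x j - γ))

/-- Draw and test at most `r` further fresh distributions, the next one having index `i`, each
with at most `m` samples, until one is declared heavy; `T` samples were taken before. -/
def searchArms (A B γ : ℝ) (m : ℕ) (x : ℕ → ℕ → ℝ) : ℕ → ℕ → ℕ → State
  | 0, i, T => ⟨none, i, T⟩
  | r + 1, i, T =>
    if (testArm A B γ (x i) m 0 0).1 = true then
      ⟨some i, i + 1, T + (testArm A B γ (x i) m 0 0).2⟩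
    else searchArms A B γ m x r (i + 1) (T + (testArm A B γ (x i) m 0 0).2)

/-- `n = ⌈2 log 9 / α₀⌉`, the number of distributions tested. -/
def numArms (α₀ : ℝ) : ℕ := ⌈2 * Real.log 9 / α₀⌉₊

/-- `m = ⌈64 ε₀⁻² log (14 n / δ)⌉`, the largest number of samples of a tested distribution. -/
def maxSamples (α₀ ε₀ δ : ℝ) : ℕ := ⌈64 * (ε₀ ^ 2)⁻¹ * Real.log (14 * numArms α₀ / δ)⌉₊

/-- The lower threshold `A = -8 ε₀⁻¹ log 21`. -/
def lowerThreshold (ε₀ : ℝ) : ℝ := -8 * ε₀⁻¹ * Real.log 21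

/-- The upper threshold `B = 8 ε₀⁻¹ log (14 n / δ)`. -/
def upperThreshold (α₀ ε₀ δ : ℝ) : ℝ := 8 * ε₀⁻¹ * Real.log (14 * numArms α₀ / δ)

/-- `k₂ = ⌈8 ε₀⁻² log (2 k₁ / min {δ / 8, m⁻¹ ε₀⁻²})⌉` with `k₁ = 5`. -/
def calibrationSamples (α₀ ε₀ δ : ℝ) : ℕ :=
  ⌈8 * (ε₀ ^ 2)⁻¹ *
    Real.log (2 * 5 / min (δ / 8) ((maxSamples α₀ ε₀ δ : ℝ)⁻¹ * (ε₀ ^ 2)⁻¹))⌉₊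

/-- `θ̂₀`: the least of the empirical means, over `k₂` samples each, of the `k₁ = 5`
distributions with indices `s, …, s + 4`. -/
def lightEstimate (k₂ : ℕ) (x : ℕ → ℕ → ℝ) (s : ℕ) : ℝ :=
  ⨅ i : Fin 5, (∑ j ∈ Finset.range k₂, x (s + i) j) / k₂

/-- The adaptive strategy with inputs `α₀, ε₀, δ` (lower bounds on the proportion of heavy
distributions and on the gap), run on the fresh distributions with indices `s, s + 1, …`. -/
def boundedSearch (α₀ ε₀ δ : ℝ) (x : ℕ → ℕ → ℝ) (s : ℕ) : State :=
  searchArms (lowerThreshold ε₀) (upperThreshold α₀ ε₀ δ)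
    (lightEstimate (calibrationSamples α₀ ε₀ δ) x s + ε₀ / 2) (maxSamples α₀ ε₀ δ) x
    (numArms α₀) (s + 5) (5 * calibrationSamples α₀ ε₀ δ)

/-- `γ_ℓ = 2 ^ ℓ`. -/
def stageGamma (l : ℕ) : ℝ := 2 ^ l

/-- `δ_ℓ = δ / (2 ℓ³)`. -/
def stageDelta (δ : ℝ) (l : ℕ) : ℝ := δ / (2 * (l : ℝ) ^ 3)

/-- `α_k = 2 ^ k / γ_ℓ`. -/
def landmarkAlpha (l k : ℕ) : ℝ := 2 ^ k / stageGamma l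

/-- `ε_k = √(1 / (2 α_k γ_ℓ))`. -/
def landmarkEps (l k : ℕ) : ℝ := √(1 / (2 * landmarkAlpha l k * stageGamma l))

/-- The state after the first `K` landmarks `k = 0, …, K - 1` of stage `l`, started from the
state `s`; nothing is done any more once a distribution has been declared heavy. -/
def landmarkLoop (δ : ℝ) (l : ℕ) (x : ℕ → ℕ → ℝ) (s : State) : ℕ → State
  | 0 => s
  | k + 1 =>
    let t := landmarkLoop δ l x s k
    if t.output.isSome = true then t
    else
      let r := boundedSearch (landmarkAlpha l k) (landmarkEps l k) (stageDelta δ l) x t.nextArm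
      ⟨r.output, r.nextArm, t.samples + r.samples⟩

/-- The state of the adaptive strategy for unknown parameters after the stages `ℓ = 1, …, L`,
where stage `ℓ` runs through the landmarks `k = 0, …, ℓ`. -/
def stages (δ : ℝ) (x : ℕ → ℕ → ℝ) : ℕ → State
  | 0 => ⟨none, 0, 0⟩
  | L + 1 => landmarkLoop δ (L + 1) x (stages δ x L) (L + 2)

/-- The strategy for unknown parameters stops and returns distribution `h`. -/
def Returns (δ : ℝ) (x : ℕ → ℕ → ℝ) (h : ℕ) : Prop :=
  ∃ L, (stages δ x L).output = some h

/-- The total number of samples taken by the strategy for unknown parameters; it is `∞` if the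
strategy never stops. -/
def totalSamples (δ : ℝ) (x : ℕ → ℕ → ℝ) : ENNReal :=
  ⨆ L, ((stages δ x L).samples : ENNReal)

end

end MostBiasedCoin

namespace MostBiasedCoin

noncomputable section

open MeasureTheory ProbabilityTheory

/-! The argument separates what a run of the subroutine guarantees for arbitrary guesses from what
it guarantees for good ones. Call the calibration accurate if each of the five empirical means is
within `ε₀ / 4` of the mean of its own distribution. The least of them is then at least `θ₀ - ε₀ /
4`, so the centre of the test is at least `θ₀ + ε₀ / 4`, and a light distribution gives a walk with
negative drift. Hence, whatever the guesses are, a light distribution is declared heavy with small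
probability (exponential supermartingale), and a light test takes `O(ε₀⁻²)` samples in mean (Wald),
while a heavy one, met with probability `α`, takes at most `m`. This gives
`IsBag.measure_light_output_le` and `IsBag.lintegral_runCost_le`. If moreover `α₀ ≤ α`, `ε₀ ≤ θ₁ -
θ₀` and one of the five is light, the centre is at most `θ₁ - ε₀ / 4`. Each heavy distribution is
then accepted with probability at least `3 / 4`, and the run returns null with probability at most
`1 / 4` (`IsBag.measure_null_le`). The landmarks of stage `ℓ` lie on the curve `α_k ε_k² = 2 ^ (-ℓ -
1)`, so they all have the same cost bound, of order `2 ^ ℓ (1 + α ℓ + log ℓ + log (1 / δ))`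
(`landmark_cost_le`). Some `M` with `2 ^ M ≤ 1 / (α ε²)` is such that every stage after `M` contains
a good landmark (`exists_sufficient_landmark`). The probability of reaching later stages thus decays
like `4 ^ (-j)`, which beats the growth `2 ^ j` of the cost, and the sum is of the order of the
first `M` stages (`sum_stage_cost_le`). Correctness is a union bound: the procedure stops almost
surely, and the errors `δ_ℓ / 4` over all landmarks sum to at most `δ`. Independence between stages
holds because a null run consumes a deterministic number of distributions: as long as there is no
output, each run acts on a fixed block of indices. -/

/-! ### Independence of functionals of disjoint coordinates, and elementary properties of the test.
-/

theorem indepFun_restrict {ι Ω : Type*} {β : ι → Type*} [MeasurableSpace Ω]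
    [∀ i, MeasurableSpace (β i)] {P : Measure Ω} {Y : ∀ i, Ω → β i} (hY : iIndepFun Y P)
    (hm : ∀ i, Measurable (Y i)) {S T : Set ι} (hST : Disjoint S T) :
    IndepFun (fun ω (i : S) => Y i ω) (fun ω (i : T) => Y i ω) P := by
  have h := indep_iSup_of_disjoint (fun i => (hm i).comap_le) hY hST
  have hpi : ∀ R : Set ι, MeasurableSpace.comap (fun ω (i : R) => Y i ω) inferInstance ≤
      ⨆ i ∈ R, MeasurableSpace.comap (Y i) inferInstance := by
    intro R
    rw [MeasurableSpace.pi, MeasurableSpace.comap_iSup]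
    refine iSup_le fun i => ?_
    rw [MeasurableSpace.comap_comp]
    exact le_iSup₂_of_le i.1 i.2 le_rfl
  rw [IndepFun_iff_Indep]
  exact indep_of_indep_of_le h (hpi S) (hpi T)

/-- A functional that depends only on `S` factors measurably through the restriction to `S`: extend
the restricted family by a constant `b` and apply the functional. -/
theorem indepFun_of_dependsOn {ι Ω β γ γ' : Type*} [MeasurableSpace Ω] [MeasurableSpace β]
    [Nonempty β] [MeasurableSpace γ] [MeasurableSpace γ'] {P : Measure Ω} {Y : ι → Ω → β}
    (hY : iIndepFun Y P) (hm : ∀ i, Measurable (Y i)) {S T : Set ι} (hST : Disjoint S T)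
    {U : (ι → β) → γ} {V : (ι → β) → γ'} (hU : Measurable U) (hV : Measurable V)
    (dU : DependsOn U S) (dV : DependsOn V T) :
    IndepFun (fun ω => U (fun i => Y i ω)) (fun ω => V (fun i => Y i ω)) P := by
  classical
  obtain ⟨b⟩ := ‹Nonempty β›
  let ext (R : Set ι) (z : R → β) (i : ι) : β := if h : i ∈ R then z ⟨i, h⟩ else b
  have hext : ∀ R, Measurable (ext R) := by
    intro R
    refine measurable_pi_lambda _ fun i => ?_
    by_cases h : i ∈ R
    · simpa [ext, h] using measurable_pi_apply _
    · simp [ext, h]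
  have h := (indepFun_restrict hY hm hST).comp (hU.comp (hext S)) (hV.comp (hext T))
  have e1 : (fun ω => U (fun i => Y i ω)) = (U ∘ ext S) ∘ (fun ω (i : S) => Y i ω) := by
    ext1 ω
    exact dU fun i hi => by simp [ext, hi]
  have e2 : (fun ω => V (fun i => Y i ω)) = (V ∘ ext T) ∘ (fun ω (i : T) => Y i ω) := by
    ext1 ω
    exact dV fun i hi => by simp [ext, hi]
  rwa [e1, e2]

/-- Fubini for the joint law, which is a product. It serves to freeze one of two independent
variables. -/
theorem lintegral_eq_lintegral_lintegral_of_indepFun {Ω β γ : Type*} [MeasurableSpace Ω]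
    [MeasurableSpace β] [MeasurableSpace γ] {P : Measure Ω} [IsProbabilityMeasure P]
    {U : Ω → β} {V : Ω → γ} (hUV : IndepFun U V P) (hU : Measurable U) (hV : Measurable V)
    {g : β → γ → ENNReal} (hg : Measurable (Function.uncurry g)) :
    ∫⁻ ω, g (U ω) (V ω) ∂P = ∫⁻ ω', ∫⁻ ω, g (U ω') (V ω) ∂P ∂P := by
  have h := (indepFun_iff_map_prod_eq_prod_map_map hU.aemeasurable hV.aemeasurable).1 hUV
  have : ∫⁻ ω, g (U ω) (V ω) ∂P =
      ∫⁻ p, Function.uncurry g p ∂(P.map fun ω => (U ω, V ω)) := by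
    rw [lintegral_map hg (hU.prodMk hV)]; rfl
  have hpm : IsProbabilityMeasure (P.map V) := Measure.isProbabilityMeasure_map hV.aemeasurable
  rw [this, h, lintegral_prod _ hg.aemeasurable, lintegral_map hg.lintegral_prod_right' hU]
  refine lintegral_congr fun ω' => ?_
  exact lintegral_map (f := fun v => Function.uncurry g (U ω', v))
    (hg.comp measurable_prodMk_left) hV

theorem testArm_congr {A B γ : ℝ} {x y : ℕ → ℝ} :
    ∀ (r j : ℕ) (S : ℝ), (∀ k, j ≤ k → k < j + r → x k = y k) →
      testArm A B γ x r j S = testArm A B γ y r j S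
  | 0, _, _, _ => rfl
  | r + 1, j, S, h => by
    simp only [testArm, h j le_rfl (by omega)]
    rw [testArm_congr r (j + 1) _ fun k h1 h2 => h k (by omega) (by omega)]

theorem testArm_samples_le {A B γ : ℝ} {x : ℕ → ℝ} :
    ∀ (r j : ℕ) (S : ℝ), (testArm A B γ x r j S).2 ≤ j + r
  | 0, _, _ => le_rfl
  | r + 1, j, S => by
    have := testArm_samples_le (A := A) (B := B) (γ := γ) (x := x) r (j + 1) (S + (x j - γ))
    simp only [testArm]
    split_ifs <;> grind

theorem measurable_testArm (A B : ℝ) (r j : ℕ) :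
    Measurable fun p : (ℝ × (ℕ → ℝ)) × ℝ => testArm A B p.1.1 p.1.2 r j p.2 := by
  induction r generalizing j with
  | zero => exact measurable_const
  | succ r ih =>
    have hs : Measurable fun p : (ℝ × (ℕ → ℝ)) × ℝ => p.2 + (p.1.2 j - p.1.1) := by
      fun_prop
    refine Measurable.ite (measurableSet_lt measurable_const hs) measurable_const ?_
    refine Measurable.ite (measurableSet_lt hs measurable_const) measurable_const ?_
    exact (ih (j + 1)).comp (measurable_fst.prodMk hs)

/-! ### The sequential test of one distribution as a stopped random walk. -/

section SingleArm

variable {Ω : Type*} [MeasurableSpace Ω] {Q : Measure Ω} [IsProbabilityMeasure Q]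
  {X : ℕ → Ω → ℝ}

/-- Conditioning on the next sample: the rest of the test reads only later samples, which `mask`
isolates. This recursion replaces stopping times, so that the martingale bounds below become
inductions on the number of remaining samples. -/
theorem lintegral_testArm_succ (hX : iIndepFun X Q) (hm : ∀ j, Measurable (X j))
    (A B γ : ℝ) (r j : ℕ) (S : ℝ) (φ : Bool × ℕ → ENNReal) :
    ∫⁻ ω, φ (testArm A B γ (fun k => X k ω) (r + 1) j S) ∂Q =
      ∫⁻ ω', (if S + (X j ω' - γ) > B then φ (true, j + 1)
        else if S + (X j ω' - γ) < A then φ (false, j + 1)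
        else ∫⁻ ω, φ (testArm A B γ (fun k => X k ω) r (j + 1) (S + (X j ω' - γ))) ∂Q) ∂Q := by
  let mask (x : ℕ → ℝ) (k : ℕ) : ℝ := if k ≤ j then 0 else x k
  have hmask : Measurable mask := by
    refine measurable_pi_lambda _ fun k => ?_
    by_cases h : k ≤ j
    · simp [mask, h]
    · simpa [mask, h] using measurable_pi_apply _
  have hind : IndepFun (X j) (fun ω => mask fun k => X k ω) Q := by
    refine indepFun_of_dependsOn (S := {j}) (T := {k | j < k}) (U := fun x => x j) (V := mask)
      hX hm (by simp) (measurable_pi_apply j) hmask ?_ ?_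
    · intro x y h; exact h j rfl
    · intro x y h
      ext k
      by_cases hk : k ≤ j
      · simp [mask, hk]
      · simpa [mask, hk] using h k (by simpa using hk)
  let g (u : ℝ) (w : ℕ → ℝ) : ENNReal :=
    if S + (u - γ) > B then φ (true, j + 1)
        else if S + (u - γ) < A then φ (false, j + 1)
        else φ (testArm A B γ w r (j + 1) (S + (u - γ)))
  have hφ : Measurable φ := Measurable.of_discrete
  have hg : Measurable (Function.uncurry g) := by
    have hs : Measurable fun p : ℝ × (ℕ → ℝ) => S + (p.1 - γ) := by fun_prop
    refine Measurable.ite (measurableSet_lt measurable_const hs) measurable_const ?_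
    refine Measurable.ite (measurableSet_lt hs measurable_const) measurable_const ?_
    exact hφ.comp ((measurable_testArm A B r (j + 1)).comp
      ((measurable_const.prodMk measurable_snd).prodMk hs))
  have hmk : ∀ x s, testArm A B γ (mask x) r (j + 1) s = testArm A B γ x r (j + 1) s := by
    intro x s
    exact testArm_congr _ _ _ fun k h1 _ => by simp [mask, show ¬ k ≤ j by omega]
  have hdec := lintegral_eq_lintegral_lintegral_of_indepFun hind (hm j)
    (hmask.comp (measurable_pi_lambda _ hm)) hg
  have hl : ∀ ω, φ (testArm A B γ (fun k => X k ω) (r + 1) j S) =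
      g (X j ω) (mask fun k => X k ω) := by
    intro ω
    simp only [testArm, g, hmk]
    split_ifs <;> rfl
  simp_rw [hl]
  rw [hdec]
  refine lintegral_congr fun ω' => ?_
  simp only [g, hmk]
  split_ifs <;> simp

/-- Maximal inequality for the upper threshold under a negative drift. -/
theorem measure_testArm_true_le (hX : iIndepFun X Q) (hm : ∀ j, Measurable (X j))
    {A B γ t : ℝ} (ht : 0 ≤ t)
    (hexp : ∀ j, ∫⁻ ω, ENNReal.ofReal (Real.exp (t * (X j ω - γ))) ∂Q ≤ 1) (r j : ℕ) (S : ℝ) :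
    ∫⁻ ω, (if (testArm A B γ (fun k => X k ω) r j S).1 = true then 1 else 0) ∂Q ≤
      ENNReal.ofReal (Real.exp (t * (S - B))) := by
  induction r generalizing j S with
  | zero => simp [testArm]
  | succ r ih =>
    rw [lintegral_testArm_succ hX hm A B γ r j S (fun p => if p.1 = true then 1 else 0)]
    -- The majorant `exp (t (S - B))` is at least `1` once the sum exceeds `B`, and `hexp` makes it
    -- a supermartingale.
    calc _ ≤ ∫⁻ ω, ENNReal.ofReal (Real.exp (t * (S - B))) *
          ENNReal.ofReal (Real.exp (t * (X j ω - γ))) ∂Q := by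
          refine lintegral_mono fun ω => ?_
          rw [← ENNReal.ofReal_mul (Real.exp_pos _).le, ← Real.exp_add]
          have he : t * (S - B) + t * (X j ω - γ) = t * (S + (X j ω - γ) - B) := by ring
          rw [he]
          dsimp only
          split_ifs with h1 h2 h3 h3
          · rw [ENNReal.one_le_ofReal, Real.one_le_exp_iff]
            exact mul_nonneg ht (by linarith)
          · simp at *
          · simp at h3
          · simp
          · exact ih _ _
      _ ≤ _ := by
        rw [lintegral_const_mul' _ _ ENNReal.ofReal_ne_top]
        exact mul_le_of_le_one_right' (hexp j)

/-- Under a positive drift, the test rejects only if the sum falls below the lower threshold or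
is still below the upper threshold at the end. -/
theorem measure_testArm_false_le (hX : iIndepFun X Q) (hm : ∀ j, Measurable (X j))
    {A B γ t u ρ : ℝ} (ht : 0 ≤ t) (hu : 0 ≤ u) (hρ : 0 ≤ ρ)
    (hexp : ∀ j, ∫⁻ ω, ENNReal.ofReal (Real.exp (-t * (X j ω - γ))) ∂Q ≤ 1)
    (hexp' : ∀ j, ∫⁻ ω, ENNReal.ofReal (Real.exp (-u * (X j ω - γ))) ∂Q ≤ ENNReal.ofReal ρ)
    (r j : ℕ) (S : ℝ) (hS : S ≤ B) :
    ∫⁻ ω, (if (testArm A B γ (fun k => X k ω) r j S).1 = false then 1 else 0) ∂Q ≤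
      ENNReal.ofReal (Real.exp (-t * (S - A))) +
        ENNReal.ofReal (Real.exp (-u * (S - B))) * ENNReal.ofReal (ρ ^ r) := by
  induction r generalizing j S with
  | zero =>
    simp only [testArm, if_true, lintegral_const, measure_univ, mul_one, pow_zero,
      ENNReal.ofReal_one]
    -- No samples are left and the test rejects; since the sum never exceeded `B`, the second
    -- exponential is at least `1`.
    refine le_add_left ?_
    rw [ENNReal.one_le_ofReal, Real.one_le_exp_iff]
    nlinarith
  | succ r ih =>
    rw [lintegral_testArm_succ hX hm A B γ r j S (fun p => if p.1 = false then 1 else 0)]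
    -- The first exponential pays for a fall below `A`, the second for running out of samples; the
    -- latter shrinks by a factor `ρ` per sample.
    calc _ ≤ ∫⁻ ω, (ENNReal.ofReal (Real.exp (-t * (S - A))) *
          ENNReal.ofReal (Real.exp (-t * (X j ω - γ))) +
          (ENNReal.ofReal (Real.exp (-u * (S - B))) * ENNReal.ofReal (ρ ^ r)) *
            ENNReal.ofReal (Real.exp (-u * (X j ω - γ)))) ∂Q := by
          refine lintegral_mono fun ω => ?_
          rw [← ENNReal.ofReal_mul (Real.exp_pos _).le, ← Real.exp_add, mul_right_comm,
            ← ENNReal.ofReal_mul (Real.exp_pos _).le, ← Real.exp_add]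
          have he : -t * (S - A) + -t * (X j ω - γ) = -t * (S + (X j ω - γ) - A) := by ring
          have he' : -u * (S - B) + -u * (X j ω - γ) = -u * (S + (X j ω - γ) - B) := by ring
          rw [he, he']
          dsimp only
          split_ifs with h1 h2 h3 h3
          · simp at *
          · simp
          · refine le_add_right ?_
            rw [ENNReal.one_le_ofReal, Real.one_le_exp_iff]
            nlinarith
          · simp at h3
          · exact ih _ _ (not_lt.1 h1)
      _ ≤ _ := by
        have hmeas : ∀ c : ℝ, Measurable fun ω => ENNReal.ofReal (Real.exp (c * (X j ω - γ))) := by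
          intro c
          have := hm j
          fun_prop
        rw [lintegral_add_left ((hmeas _).const_mul _),
          lintegral_const_mul' _ _ ENNReal.ofReal_ne_top,
          lintegral_const_mul' _ _ (by finiteness)]
        refine add_le_add (mul_le_of_le_one_right' (hexp j)) ?_
        rw [pow_succ, ENNReal.ofReal_mul (pow_nonneg hρ r), ← mul_assoc]
        gcongr
        exact hexp' j

/-- Wald-type bound on the number of samples under a negative drift. -/
theorem lintegral_testArm_samples_le (hX : iIndepFun X Q) (hm : ∀ j, Measurable (X j))
    (hmem : ∀ j, ∀ᵐ ω ∂Q, X j ω ∈ Set.Icc (0 : ℝ) 1)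
    {A B γ d : ℝ} (hd : 0 < d) (hγ : γ ≤ 2) (hmean : ∀ j, ∫ ω, X j ω ∂Q ≤ γ - d)
    (r j : ℕ) (S : ℝ) (hS : A ≤ S) :
    ∫⁻ ω, ((testArm A B γ (fun k => X k ω) r j S).2 : ENNReal) ∂Q ≤
      j + ENNReal.ofReal ((S - A + 2) / d) := by
  induction r generalizing j S with
  | zero => simp [testArm]
  | succ r ih =>
    rw [lintegral_testArm_succ hX hm A B γ r j S (fun p => (p.2 : ENNReal))]
    have hint : Integrable (X j) Q := Integrable.of_mem_Icc 0 1 (hm j).aemeasurable (hmem j)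
    -- The potential `(S - A + 2) / d` drops by at least `1` in mean per sample. The `2` covers the
    -- overshoot below `A`, since an increment is at least `-γ ≥ -2`, and keeps the potential
    -- nonnegative.
    calc _ ≤ ∫⁻ ω, (((j + 1 : ℕ) : ENNReal) +
          ENNReal.ofReal ((S + (X j ω - γ) - A + 2) / d)) ∂Q := by
          refine lintegral_mono fun ω => ?_
          dsimp only
          split_ifs with h1 h2
          · exact le_add_right le_rfl
          · exact le_add_right le_rfl
          · exact ih _ _ (not_lt.1 h2)
      _ = ((j + 1 : ℕ) : ENNReal) +
          ENNReal.ofReal (∫ ω, (S + (X j ω - γ) - A + 2) / d ∂Q) := by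
        rw [lintegral_add_left measurable_const, lintegral_const, measure_univ, mul_one,
          ofReal_integral_eq_lintegral_ofReal]
        · exact ((((integrable_const S).add (hint.sub (integrable_const γ))).sub
            (integrable_const A)).add (integrable_const 2)).div_const d
        · filter_upwards [hmem j] with ω hω
          exact div_nonneg (by linarith [hω.1]) hd.le
      _ ≤ _ := by
        have hI : ∫ ω, (S + (X j ω - γ) - A + 2) / d ∂Q =
            (S - A + 2 + (∫ ω, X j ω ∂Q - γ)) / d := by
          rw [integral_div]
          congr 1
          have : ∀ ω, S + (X j ω - γ) - A + 2 = X j ω + (S - γ - A + 2) := fun ω => by ring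
          simp_rw [this]
          rw [integral_add hint (integrable_const _), integral_const]
          simp
          ring
        have h0 : 0 ≤ ∫ ω, X j ω ∂Q := integral_nonneg_of_ae <| by
          filter_upwards [hmem j] with ω hω using hω.1
        rw [hI, Nat.cast_succ, add_assoc, ← ENNReal.ofReal_one,
          ← ENNReal.ofReal_add zero_le_one (div_nonneg (by linarith) hd.le)]
        gcongr
        rw [← sub_nonneg, show (S - A + 2) / d -
          (1 + (S - A + 2 + (∫ ω, X j ω ∂Q - γ)) / d) = (γ - d - ∫ ω, X j ω ∂Q) / d by
            field_simp; ring]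
        exact div_nonneg (sub_nonneg.2 (hmean j)) hd.le

end SingleArm

/-! ### Hoeffding bounds, and the error probabilities of the test. -/

section Concentration

variable {Ω : Type*} [MeasurableSpace Ω] {Q : Measure Ω} [IsProbabilityMeasure Q]

theorem hasSubgaussianMGF_of_mem_unit {X : Ω → ℝ} (hm : Measurable X)
    (hmem : ∀ᵐ ω ∂Q, X ω ∈ Set.Icc (0 : ℝ) 1) :
    HasSubgaussianMGF (fun ω => X ω - ∫ ω, X ω ∂Q) (1 / 4) Q := by
  have h := hasSubgaussianMGF_of_mem_Icc hm.aemeasurable hmem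
  have : ((‖(1 : ℝ) - 0‖₊ / 2) ^ 2 : NNReal) = 1 / 4 := by
    simp only [sub_zero, nnnorm_one]; norm_num
  rwa [this] at h

theorem lintegral_exp_le_of_mem_unit {X : Ω → ℝ} (hm : Measurable X)
    (hmem : ∀ᵐ ω ∂Q, X ω ∈ Set.Icc (0 : ℝ) 1) {θ : ℝ} (hθ : ∫ ω, X ω ∂Q = θ) (t γ : ℝ) :
    ∫⁻ ω, ENNReal.ofReal (Real.exp (t * (X ω - γ))) ∂Q ≤
      ENNReal.ofReal (Real.exp (t * (θ - γ) + t ^ 2 / 8)) := by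
  have h := hasSubgaussianMGF_of_mem_unit hm hmem
  have h1 := h.mgf_le t
  have hi := h.integrable_exp_mul t
  rw [hθ] at h1 hi
  have e : ∀ ω, Real.exp (t * (X ω - γ)) =
      Real.exp (t * (θ - γ)) * Real.exp (t * (X ω - θ)) := by
    intro ω; rw [← Real.exp_add]; congr 1; ring
  rw [← ofReal_integral_eq_lintegral_ofReal]
  · refine ENNReal.ofReal_le_ofReal ?_
    simp_rw [e]
    rw [integral_const_mul, Real.exp_add]
    refine mul_le_mul_of_nonneg_left (h1.trans_eq ?_) (Real.exp_pos _).le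
    congr 1
    push_cast
    ring
  · simp_rw [e]
    exact hi.const_mul _
  · exact Filter.Eventually.of_forall fun ω => (Real.exp_pos _).le

/-- Hoeffding's inequality for empirical means. -/
theorem measure_lt_abs_average_sub_le {X : ℕ → Ω → ℝ} (hX : iIndepFun X Q)
    (hm : ∀ j, Measurable (X j)) (hmem : ∀ j, ∀ᵐ ω ∂Q, X j ω ∈ Set.Icc (0 : ℝ) 1) {θ : ℝ}
    (hθ : ∀ j, ∫ ω, X j ω ∂Q = θ) {k : ℕ} (hk : 0 < k) {η : ℝ} (hη : 0 ≤ η) :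
    Q {ω | η < |(∑ j ∈ Finset.range k, X j ω) / k - θ|} ≤
      ENNReal.ofReal (2 * Real.exp (-(2 * k * η ^ 2))) := by
  have hk' : (0 : ℝ) < k := by exact_mod_cast hk
  have hexp : -(k * η) ^ 2 / (2 * k * ((1 / 4 : NNReal) : ℝ)) = -(2 * k * η ^ 2) := by
    push_cast
    field_simp
    ring
  have hsub : ∀ j, HasSubgaussianMGF (fun ω => X j ω - θ) (1 / 4) Q := fun j => by
    have := hasSubgaussianMGF_of_mem_unit (hm j) (hmem j)
    rwa [hθ j] at this
  have hind : iIndepFun (fun j ω => X j ω - θ) Q :=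
    hX.comp (fun _ u => u - θ) fun _ => measurable_id.sub_const θ
  have hind' : iIndepFun (fun j ω => -(X j ω - θ)) Q :=
    hX.comp (fun _ u => -(u - θ)) fun _ => (measurable_id.sub_const θ).neg
  have h1 := HasSubgaussianMGF.measure_sum_range_ge_le_of_iIndepFun (n := k) hind
    (fun j _ => hsub j) (mul_nonneg hk'.le hη)
  have h2 := HasSubgaussianMGF.measure_sum_range_ge_le_of_iIndepFun (n := k) hind'
    (fun j _ => (hsub j).neg) (mul_nonneg hk'.le hη)
  rw [hexp] at h1 h2
  have hsub : {ω | η < |(∑ j ∈ Finset.range k, X j ω) / k - θ|} ⊆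
      {ω | k * η ≤ ∑ j ∈ Finset.range k, (X j ω - θ)} ∪
        {ω | k * η ≤ ∑ j ∈ Finset.range k, -(X j ω - θ)} := by
    intro ω hω
    have e : (∑ j ∈ Finset.range k, X j ω) / k - θ =
        (∑ j ∈ Finset.range k, (X j ω - θ)) / k := by
      rw [Finset.sum_sub_distrib]
      simp
      field_simp
    rw [Set.mem_ofPred_eq, e, lt_abs] at hω
    rcases hω with hω | hω
    · left
      rw [lt_div_iff₀ hk'] at hω
      simp only [Set.mem_ofPred_eq]
      linarith
    · right
      rw [← neg_div, lt_div_iff₀ hk'] at hω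
      simp only [Set.mem_ofPred_eq, Finset.sum_neg_distrib]
      linarith
  refine (measure_mono hsub).trans ((measure_union_le _ _).trans ?_)
  rw [two_mul, ENNReal.ofReal_add (Real.exp_pos _).le (Real.exp_pos _).le]
  refine add_le_add ?_ ?_
  · rw [← ofReal_measureReal]; exact ENNReal.ofReal_le_ofReal h1
  · rw [← ofReal_measureReal]; exact ENNReal.ofReal_le_ofReal h2

/-- A light distribution is declared heavy with small probability. -/
theorem measure_testArm_true_le_of_light {X : ℕ → Ω → ℝ} (hX : iIndepFun X Q)
    (hm : ∀ j, Measurable (X j)) (hmem : ∀ j, ∀ᵐ ω ∂Q, X j ω ∈ Set.Icc (0 : ℝ) 1) {θ : ℝ}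
    (hθ : ∀ j, ∫ ω, X j ω ∂Q = θ) {A B γ e : ℝ} (he : 0 ≤ e) (hγ : θ + e / 4 ≤ γ) (m : ℕ) :
    ∫⁻ ω, (if (testArm A B γ (fun k => X k ω) m 0 0).1 = true then 1 else 0) ∂Q ≤
      ENNReal.ofReal (Real.exp (-(2 * e * B))) := by
  -- `t = 2 e` is the zero of `-t e / 4 + t² / 8`, hence the largest exponent that still gives a
  -- supermartingale at drift `-e / 4`.
  have h := measure_testArm_true_le (A := A) (B := B) (γ := γ) (t := 2 * e) hX hm (by positivity)
    (fun j => (lintegral_exp_le_of_mem_unit (hm j) (hmem j) (hθ j) _ γ).trans <| by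
      rw [ENNReal.ofReal_le_one, Real.exp_le_one_iff]
      nlinarith) m 0 0
  convert h using 3
  ring

/-- A heavy distribution is rejected with small probability. -/
theorem measure_testArm_false_le_of_heavy {X : ℕ → Ω → ℝ} (hX : iIndepFun X Q)
    (hm : ∀ j, Measurable (X j)) (hmem : ∀ j, ∀ᵐ ω ∂Q, X j ω ∈ Set.Icc (0 : ℝ) 1) {θ : ℝ}
    (hθ : ∀ j, ∫ ω, X j ω ∂Q = θ) {A B γ e : ℝ} (he : 0 ≤ e) (hB : 0 ≤ B)
    (hγ : γ ≤ θ - e / 4) (m : ℕ) :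
    ∫⁻ ω, (if (testArm A B γ (fun k => X k ω) m 0 0).1 = false then 1 else 0) ∂Q ≤
      ENNReal.ofReal (Real.exp (2 * e * A) + Real.exp (e / 2 * B - 3 * e ^ 2 / 32 * m)) := by
  -- The best rate per sample would be at `u = e`, but for `B = 8 Λ / e` and `m = 64 Λ / e²` the
  -- term `u B` then cancels the gain. `u = e / 2` is the optimum: `4 Λ - 6 Λ = -2 Λ`.
  have h := measure_testArm_false_le (A := A) (B := B) (γ := γ) (t := 2 * e) (u := e / 2)
    (ρ := Real.exp (-(3 * e ^ 2 / 32))) hX hm (by positivity) (by positivity)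
    (Real.exp_pos _).le
    (fun j => (lintegral_exp_le_of_mem_unit (hm j) (hmem j) (hθ j) _ γ).trans <| by
      rw [ENNReal.ofReal_le_one, Real.exp_le_one_iff]
      nlinarith)
    (fun j => (lintegral_exp_le_of_mem_unit (hm j) (hmem j) (hθ j) _ γ).trans <| by
      refine ENNReal.ofReal_le_ofReal (Real.exp_le_exp.2 ?_)
      nlinarith) m 0 0 hB
  refine h.trans_eq ?_
  rw [← ENNReal.ofReal_mul (Real.exp_pos _).le, ← ENNReal.ofReal_add (Real.exp_pos _).le
    (by positivity), ← Real.exp_nat_mul, ← Real.exp_add]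
  congr 3 <;> ring

end Concentration

/-! ### Calibration, total expectation over the kind, and freezing of the estimate. -/

section Bag

/-- The mean of the samples of a distribution of kind `b`. -/
def kindMean (θ₀ θ₁ : ℝ) (b : Bool) : ℝ := if b then θ₁ else θ₀

/-- The calibration on the distributions `s, …, s + 4` is accurate up to `η`. -/
def Calibrated (θ₀ θ₁ η : ℝ) (k s : ℕ) (y : ℕ → Bool × (ℕ → ℝ)) : Prop :=
  ∀ i : Fin 5,
    |(∑ j ∈ Finset.range k, (y (s + i)).2 j) / k - kindMean θ₀ θ₁ (y (s + i)).1| ≤ η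

theorem kindMean_mem {θ₀ θ₁ : ℝ} (h : θ₀ ≤ θ₁) (b : Bool) :
    kindMean θ₀ θ₁ b ∈ Set.Icc θ₀ θ₁ := by
  cases b <;> simp [kindMean, h]

/-- No mean is below `θ₀`, so this side needs no light distribution among the five; it is the side
that protects against false acceptance. -/
theorem le_lightEstimate_of_calibrated {θ₀ θ₁ η : ℝ} {k s : ℕ} {y : ℕ → Bool × (ℕ → ℝ)}
    (hθ : θ₀ ≤ θ₁) (h : Calibrated θ₀ θ₁ η k s y) :
    θ₀ - η ≤ lightEstimate k (fun i => (y i).2) s := by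
  refine le_ciInf fun i => ?_
  have := (abs_le.1 (h i)).1
  linarith [(kindMean_mem hθ (y (s + i)).1).1]

theorem lightEstimate_le_of_calibrated {θ₀ θ₁ η : ℝ} {k s : ℕ} {y : ℕ → Bool × (ℕ → ℝ)}
    (h : Calibrated θ₀ θ₁ η k s y) (i : Fin 5) :
    lightEstimate k (fun i => (y i).2) s ≤ kindMean θ₀ θ₁ (y (s + i)).1 + η := by
  refine (ciInf_le (Set.finite_range _).bddBelow i).trans ?_
  have := (abs_le.1 (h i)).2
  linarith

theorem measurable_lightEstimate (k s : ℕ) :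
    Measurable fun y : ℕ → Bool × (ℕ → ℝ) => lightEstimate k (fun i => (y i).2) s := by
  refine Measurable.iInf fun i => ?_
  fun_prop

theorem measurable_kindMean (θ₀ θ₁ : ℝ) : Measurable (kindMean θ₀ θ₁) :=
  Measurable.of_discrete

theorem measurableSet_calibrated (θ₀ θ₁ η : ℝ) (k s : ℕ) :
    MeasurableSet {y | Calibrated θ₀ θ₁ η k s y} := by
  simp only [Calibrated, Set.ofPred_forall]
  refine MeasurableSet.iInter fun i => measurableSet_le ?_ measurable_const
  have := measurable_kindMean θ₀ θ₁
  fun_prop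

theorem dependsOn_calibrated (θ₀ θ₁ η : ℝ) (k s : ℕ) :
    DependsOn (Calibrated θ₀ θ₁ η k s) (Set.Ico s (s + 5)) := by
  intro y z h
  have : ∀ i : Fin 5, y (s + i) = z (s + i) := fun i => h _ ⟨by omega, by omega⟩
  simp only [Calibrated, this]

theorem dependsOn_lightEstimate (k s : ℕ) :
    DependsOn (fun y : ℕ → Bool × (ℕ → ℝ) => lightEstimate k (fun i => (y i).2) s)
      (Set.Ico s (s + 5)) := by
  intro y z h
  have : ∀ i : Fin 5, y (s + i) = z (s + i) := fun i => h _ ⟨by omega, by omega⟩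
  simp only [lightEstimate, this]

variable {Ω : Type*} [MeasurableSpace Ω] {P : Measure Ω}
  {α θ₀ θ₁ : ℝ} {ξ : ℕ → Ω → Bool} {X : ℕ → ℕ → Ω → ℝ}

/-- Distribution `i` of the bag: its kind and its samples. -/
def draw (ξ : ℕ → Ω → Bool) (X : ℕ → ℕ → Ω → ℝ) (i : ℕ) (ω : Ω) : Bool × (ℕ → ℝ) :=
  (ξ i ω, fun j => X i j ω)

theorem IsBag.measurable_draw (h : IsBag P α θ₀ θ₁ ξ X) (i : ℕ) : Measurable (draw ξ X i) :=
  (h.measurable_kind i).prodMk (measurable_pi_lambda _ fun j => h.measurable_sample i j)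

theorem IsBag.measurable_draws (h : IsBag P α θ₀ θ₁ ξ X) :
    Measurable fun ω i => draw ξ X i ω :=
  measurable_pi_lambda _ h.measurable_draw

theorem IsBag.iIndepFun_draw (h : IsBag P α θ₀ θ₁ ξ X) : iIndepFun (draw ξ X) P :=
  h.indep_draws

theorem IsBag.measurableSet_kind (h : IsBag P α θ₀ θ₁ ξ X) (i : ℕ) (b : Bool) :
    MeasurableSet (ξ i ⁻¹' {b}) := h.measurable_kind i (measurableSet_singleton b)

theorem IsBag.integral_sample (h : IsBag P α θ₀ θ₁ ξ X) (i j : ℕ) (b : Bool) :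
    ∫ ω, X i j ω ∂(ProbabilityTheory.cond P (ξ i ⁻¹' {b})) = kindMean θ₀ θ₁ b := by
  cases b
  · exact h.mean_light i j
  · exact h.mean_heavy i j

theorem IsBag.sample_mem_cond (h : IsBag P α θ₀ θ₁ ξ X) (i j : ℕ) (b : Bool) :
    ∀ᵐ ω ∂(ProbabilityTheory.cond P (ξ i ⁻¹' {b})), X i j ω ∈ Set.Icc (0 : ℝ) 1 :=
  cond_absolutelyContinuous.ae_le (h.sample_mem i j)

variable [IsProbabilityMeasure P]

theorem IsBag.measure_heavy (h : IsBag P α θ₀ θ₁ ξ X) (i : ℕ) :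
    P (ξ i ⁻¹' {true}) = ENNReal.ofReal α := by
  rw [← h.prob_heavy i, ofReal_measureReal]

theorem IsBag.measure_light (h : IsBag P α θ₀ θ₁ ξ X) (i : ℕ) :
    P (ξ i ⁻¹' {false}) = ENNReal.ofReal (1 - α) := by
  have : ξ i ⁻¹' {false} = (ξ i ⁻¹' {true})ᶜ := by ext ω; simp
  rw [this, ← ofReal_measureReal, probReal_compl_eq_one_sub (h.measurableSet_kind i true),
    h.prob_heavy]

theorem IsBag.isProbabilityMeasure_cond (h : IsBag P α θ₀ θ₁ ξ X) (hα : 0 < α) (hα' : α < 1)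
    (i : ℕ) (b : Bool) : IsProbabilityMeasure (ProbabilityTheory.cond P (ξ i ⁻¹' {b})) := by
  refine cond_isProbabilityMeasure ?_
  cases b
  · rw [h.measure_light]; simpa using hα'
  · rw [h.measure_heavy]; simpa using hα

/-- Total expectation over the kind of distribution `i`. -/
theorem IsBag.lintegral_eq (h : IsBag P α θ₀ θ₁ ξ X) (i : ℕ) (f : Bool → Ω → ENNReal) :
    ∫⁻ ω, f (ξ i ω) ω ∂P =
      ENNReal.ofReal α * ∫⁻ ω, f true ω ∂(ProbabilityTheory.cond P (ξ i ⁻¹' {true})) +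
      ENNReal.ofReal (1 - α) *
        ∫⁻ ω, f false ω ∂(ProbabilityTheory.cond P (ξ i ⁻¹' {false})) := by
  have key : ∀ b, P (ξ i ⁻¹' {b}) *
      ∫⁻ ω, f b ω ∂(ProbabilityTheory.cond P (ξ i ⁻¹' {b})) =
      ∫⁻ ω in ξ i ⁻¹' {b}, f (ξ i ω) ω ∂P := by
    intro b
    rw [ProbabilityTheory.cond, lintegral_smul_measure, smul_eq_mul, ← mul_assoc]
    rcases eq_or_ne (P (ξ i ⁻¹' {b})) 0 with h0 | h0
    · rw [h0, Measure.restrict_eq_zero.2 h0]; simp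
    · rw [ENNReal.mul_inv_cancel h0 (measure_ne_top _ _), one_mul]
      refine setLIntegral_congr_fun (h.measurableSet_kind i b) fun ω hω => ?_
      rw [Set.mem_preimage, Set.mem_singleton_iff] at hω
      rw [hω]
  rw [← h.measure_heavy i, ← h.measure_light i, key, key]
  have : ξ i ⁻¹' {false} = (ξ i ⁻¹' {true})ᶜ := by ext ω; simp
  rw [this, lintegral_add_compl _ (h.measurableSet_kind i true)]

theorem IsBag.measure_not_calibrated_le (h : IsBag P α θ₀ θ₁ ξ X) (hα : 0 < α) (hα' : α < 1)
    {k : ℕ} (hk : 0 < k) {η : ℝ} (hη : 0 ≤ η) (s : ℕ) :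
    P {ω | ¬ Calibrated θ₀ θ₁ η k s fun i => draw ξ X i ω} ≤
      ENNReal.ofReal (10 * Real.exp (-(2 * k * η ^ 2))) := by
  have hone : ∀ i, P {ω | η < |(∑ j ∈ Finset.range k, X i j ω) / k -
      kindMean θ₀ θ₁ (ξ i ω)|} ≤ ENNReal.ofReal (2 * Real.exp (-(2 * k * η ^ 2))) := by
    intro i
    let f (b : Bool) : Ω → ENNReal := Set.indicator
      {ω | η < |(∑ j ∈ Finset.range k, X i j ω) / k - kindMean θ₀ θ₁ b|} 1
    have hms : ∀ b, MeasurableSet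
        {ω | η < |(∑ j ∈ Finset.range k, X i j ω) / k - kindMean θ₀ θ₁ b|} := by
      intro b
      refine measurableSet_lt measurable_const ?_
      have := h.measurable_sample i
      fun_prop
    have hb : ∀ b, ∫⁻ ω, f b ω ∂(ProbabilityTheory.cond P (ξ i ⁻¹' {b})) ≤
        ENNReal.ofReal (2 * Real.exp (-(2 * k * η ^ 2))) := by
      intro b
      have := h.isProbabilityMeasure_cond hα hα' i b
      rw [lintegral_indicator_one (hms b)]
      exact measure_lt_abs_average_sub_le (h.indep_samples i b) (h.measurable_sample i)
        (fun j => h.sample_mem_cond i j b) (fun j => h.integral_sample i j b) hk hη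
    calc _ ≤ ∫⁻ ω, f (ξ i ω) ω ∂P := by
          rw [← lintegral_indicator_one₀]
          · exact lintegral_mono fun ω => le_rfl
          · refine (measurableSet_lt measurable_const ?_).nullMeasurableSet
            have := h.measurable_sample i
            have := (measurable_kindMean θ₀ θ₁).comp (h.measurable_kind i)
            simp only [Function.comp_def] at this
            fun_prop
      _ ≤ _ := by
        rw [h.lintegral_eq i f]
        refine (add_le_add (mul_le_mul_right (hb true) _) (mul_le_mul_right (hb false) _)).trans_eq ?_
        rw [← add_mul, ← ENNReal.ofReal_add hα.le (by linarith)]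
        simp
  have : {ω | ¬ Calibrated θ₀ θ₁ η k s fun i => draw ξ X i ω} ⊆
      ⋃ i : Fin 5, {ω | η < |(∑ j ∈ Finset.range k, X (s + i) j ω) / k -
        kindMean θ₀ θ₁ (ξ (s + i) ω)|} := by
    intro ω hω
    simpa [Calibrated, draw] using hω
  refine (measure_mono this).trans ((measure_iUnion_fintype_le _ _).trans
    ((Finset.sum_le_sum fun (i : Fin 5) _ => hone (s + i)).trans_eq ?_))
  rw [Finset.sum_const, Finset.card_univ, Fintype.card_fin, nsmul_eq_mul,
    ← ENNReal.ofReal_natCast, ← ENNReal.ofReal_mul (by positivity)]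
  congr 1
  push_cast
  ring

/-- A procedure that uses an estimate from the distributions `s, …, s + 4` on other distributions
behaves as with a fixed value of the estimate. -/
theorem IsBag.lintegral_calibrated_le (h : IsBag P α θ₀ θ₁ ξ X) {k s : ℕ} {T : Set ℕ}
    (hT : Disjoint (Set.Ico s (s + 5)) T) {E : (ℕ → Bool × (ℕ → ℝ)) → Prop}
    (hE : MeasurableSet {y | E y}) (dE : DependsOn E (Set.Ico s (s + 5)))
    {f : ℝ → (ℕ → Bool × (ℕ → ℝ)) → ENNReal} (hf : Measurable (Function.uncurry f))
    (df : ∀ g, DependsOn (f g) T) {K : ENNReal}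
    (hK : ∀ y, E y → ∫⁻ ω, f (lightEstimate k (fun i => (y i).2) s) (fun i => draw ξ X i ω) ∂P ≤ K) :
    ∫⁻ ω in {ω | E fun i => draw ξ X i ω},
      f (lightEstimate k (fun i j => X i j ω) s) (fun i => draw ξ X i ω) ∂P ≤ K := by
  classical
  let mask (y : ℕ → Bool × (ℕ → ℝ)) (i : ℕ) : Bool × (ℕ → ℝ) := if i ∈ T then y i else default
  have hmask : Measurable mask := by
    refine measurable_pi_lambda _ fun i => ?_
    by_cases hi : i ∈ T
    · simpa [mask, hi] using measurable_pi_apply _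
    · simp [mask, hi]
  have dmask : DependsOn mask T := by
    intro y z hyz
    ext1 i
    by_cases hi : i ∈ T
    · simpa [mask, hi] using hyz i hi
    · simp [mask, hi]
  have hfm : ∀ g y, f g (mask y) = f g y := fun g y => df g fun i hi => by simp [mask, hi]
  -- The calibrating distributions enter only through this pair; carrying the indicator of `E` lets
  -- the frozen bound be invoked only where `E` holds.
  let U (y : ℕ → Bool × (ℕ → ℝ)) : ℝ × ENNReal :=
    (lightEstimate k (fun i => (y i).2) s, if E y then 1 else 0)
  have hU : Measurable U :=
    (measurable_lightEstimate k s).prodMk (Measurable.ite hE measurable_const measurable_const)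
  have dU : DependsOn U (Set.Ico s (s + 5)) := by
    intro y z hyz
    have h1 := dependsOn_lightEstimate k s hyz
    have h2 := dE hyz
    simp only at h1
    simp only [U, h1, h2]
  have hind := indepFun_of_dependsOn h.iIndepFun_draw h.measurable_draw hT hU hmask dU dmask
  have hdec := lintegral_eq_lintegral_lintegral_of_indepFun hind
    (hU.comp h.measurable_draws) (hmask.comp h.measurable_draws)
    (g := fun u y => u.2 * f u.1 y) (by
      have hp : Measurable fun a : (ℝ × ENNReal) × (ℕ → Bool × (ℕ → ℝ)) => (a.1.1, a.2) := by
        fun_prop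
      exact (measurable_snd.comp measurable_fst).mul (hf.comp hp))
  have hEm : MeasurableSet {ω | E fun i => draw ξ X i ω} := h.measurable_draws hE
  rw [← lintegral_indicator hEm]
  have hl : ∀ ω, Set.indicator {ω | E fun i => draw ξ X i ω}
      (fun ω => f (lightEstimate k (fun i j => X i j ω) s) (fun i => draw ξ X i ω)) ω =
      (U fun i => draw ξ X i ω).2 *
        f (U fun i => draw ξ X i ω).1 (mask fun i => draw ξ X i ω) := by
    intro ω
    rw [hfm]
    by_cases hω : E fun i => draw ξ X i ω
    · simp only [Set.indicator, Set.mem_ofPred_eq, U, hω, if_true, one_mul]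
      rfl
    · simp [Set.indicator, U, hω]
  rw [lintegral_congr hl, hdec]
  refine (lintegral_mono (g := fun _ => K) fun ω' => ?_).trans (by simp)
  by_cases hω : E fun i => draw ξ X i ω'
  · simp only [U, hω, if_true, one_mul, hfm]
    exact hK _ hω
  · simp [U, hω]

end Bag

/-! ### Deterministic behaviour of the search. -/

section Pathwise

variable {A B γ : ℝ} {m : ℕ} {x : ℕ → ℕ → ℝ}

theorem searchArms_output_eq_some :
    ∀ {r i T h : ℕ}, (searchArms A B γ m x r i T).output = some h →
      i ≤ h ∧ h < i + r ∧ (testArm A B γ (x h) m 0 0).1 = true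
  | 0, i, T, h, H => by simp [searchArms] at H
  | r + 1, i, T, h, H => by
    rw [searchArms] at H
    split_ifs at H with h1
    · obtain rfl : i = h := by simpa using H
      exact ⟨le_rfl, by omega, h1⟩
    · obtain ⟨h2, h3, h4⟩ := searchArms_output_eq_some H
      exact ⟨by omega, by omega, h4⟩

theorem searchArms_output_eq_none_iff :
    ∀ {r i T : ℕ}, (searchArms A B γ m x r i T).output = none ↔
      ∀ h, i ≤ h → h < i + r → (testArm A B γ (x h) m 0 0).1 = false
  | 0, i, T => by
    simp only [searchArms, true_iff]
    intro h h1 h2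
    omega
  | r + 1, i, T => by
    rw [searchArms]
    split_ifs with h1
    · simp only [false_iff]
      intro H
      simp [H i le_rfl (by omega)] at h1
    · rw [searchArms_output_eq_none_iff]
      constructor
      · intro H h h2 h3
        rcases h2.eq_or_lt with rfl | h2
        · simpa using h1
        · exact H h (by omega) (by omega)
      · intro H h h2 h3
        exact H h (by omega) (by omega)

theorem searchArms_nextArm_of_output_eq_none :
    ∀ {r i T : ℕ}, (searchArms A B γ m x r i T).output = none →
      (searchArms A B γ m x r i T).nextArm = i + r
  | 0, i, T, _ => rfl
  | r + 1, i, T, H => by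
    rw [searchArms] at H ⊢
    split_ifs at H ⊢ with h1
    rw [searchArms_nextArm_of_output_eq_none H]
    omega

theorem searchArms_samples_le :
    ∀ {r i T : ℕ}, (searchArms A B γ m x r i T).samples ≤
      T + ∑ h ∈ Finset.range r, (testArm A B γ (x (i + h)) m 0 0).2
  | 0, i, T => by simp [searchArms]
  | r + 1, i, T => by
    rw [searchArms, Finset.sum_range_succ']
    split_ifs with h1
    · simp only [add_zero]
      omega
    · refine searchArms_samples_le.trans_eq ?_
      simp only [add_zero, Nat.add_comm 1, Nat.add_assoc]
      rw [Nat.add_comm (∑ _ ∈ _, _)]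

end Pathwise

/-! ### Cost, false acceptance and total rejection for one run, with free thresholds. -/

section Bag

variable {Ω : Type*} [MeasurableSpace Ω] {P : Measure Ω} [IsProbabilityMeasure P]
  {α θ₀ θ₁ : ℝ} {ξ : ℕ → Ω → Bool} {X : ℕ → ℕ → Ω → ℝ}

theorem measurable_uncurry_testArm (A B c : ℝ) (m i : ℕ) :
    Measurable (Function.uncurry fun (g : ℝ) (y : ℕ → Bool × (ℕ → ℝ)) =>
      testArm A B (g + c) (y i).2 m 0 0) := by
  have hp : Measurable fun p : ℝ × (ℕ → Bool × (ℕ → ℝ)) => ((p.1 + c, (p.2 i).2), (0 : ℝ)) := by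
    fun_prop
  exact (measurable_testArm A B m 0).comp hp

/-- Expected number of samples of a tested distribution. -/
theorem IsBag.lintegral_samples_le (h : IsBag P α θ₀ θ₁ ξ X) (hα : 0 < α) (hα' : α < 1)
    (hθ : θ₀ < θ₁) (hθ₁ : θ₁ ≤ 1) {e A B : ℝ} (he : 0 < e) (he' : e ≤ 1)
    (hA : A ≤ 0) {k m s i : ℕ} (hi : i ∉ Set.Ico s (s + 5)) :
    ∫⁻ ω, ((testArm A B (lightEstimate k (fun i j => X i j ω) s + e / 2)
        (fun j => X i j ω) m 0 0).2 : ENNReal) ∂P ≤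
      m * ENNReal.ofReal α +
      m * P {ω | ¬ Calibrated θ₀ θ₁ (e / 4) k s fun i => draw ξ X i ω} +
        ENNReal.ofReal ((2 - A) / (e / 4)) := by
  have hEm := measurableSet_calibrated θ₀ θ₁ (e / 4) k s
  have hEm' : MeasurableSet {ω | Calibrated θ₀ θ₁ (e / 4) k s fun i => draw ξ X i ω} :=
    h.measurable_draws hEm
  have hcap : ∀ x γ, ((testArm A B γ x m 0 0).2 : ENNReal) ≤ m := fun x γ => by
    exact_mod_cast (testArm_samples_le m 0 0).trans_eq (zero_add m)
  -- Off the calibration event a test is charged its cap `m`.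
  rw [← lintegral_add_compl _ hEm', add_right_comm]
  refine add_le_add ?_ ?_
  · refine h.lintegral_calibrated_le (k := k) (s := s) (T := {i})
      (by simpa using hi)
      hEm (dependsOn_calibrated θ₀ θ₁ (e / 4) k s)
      (f := fun g y => ((testArm A B (g + e / 2) (y i).2 m 0 0).2 : ENNReal))
      ?_ ?_ ?_
    · have : Measurable fun p : Bool × ℕ => (p.2 : ENNReal) := Measurable.of_discrete
      exact this.comp (measurable_uncurry_testArm A B (e / 2) m i)
    · intro g y z hyz
      simp only [hyz i rfl]
    · intro y hy
      -- The lower bound on the estimate gives light walks the drift `-e / 4`, so only heavy ones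
      -- are charged `m`. The upper bound serves only for the centre: it is at most `θ₁ + 3 e / 4 ≤
      -- 2`.
      have hg1 := le_lightEstimate_of_calibrated hθ.le hy
      have hg2 := lightEstimate_le_of_calibrated hy 0
      have hg3 := (kindMean_mem hθ.le (y (s + (0 : Fin 5))).1).2
      set g := lightEstimate k (fun i => (y i).2) s
      rw [h.lintegral_eq i fun _ ω =>
        ((testArm A B (g + e / 2) (draw ξ X i ω).2 m 0 0).2 : ENNReal)]
      have := h.isProbabilityMeasure_cond hα hα' i
      have hl := lintegral_testArm_samples_le (A := A) (B := B) (γ := g + e / 2) (d := e / 4)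
        (h.indep_samples i false) (h.measurable_sample i)
        (fun j => h.sample_mem_cond i j false) (by linarith) (by linarith)
        (fun j => by rw [h.mean_light]; linarith) m 0 0 hA
      refine add_le_add ?_ ?_
      · rw [mul_comm]
        gcongr
        exact (lintegral_mono fun ω => hcap _ _).trans (by simp)
      · calc _ ≤ 1 * ENNReal.ofReal ((2 - A) / (e / 4)) := by
              refine mul_le_mul' (ENNReal.ofReal_le_one.2 (by linarith)) (hl.trans_eq ?_)
              rw [Nat.cast_zero, zero_add]
              congr 2
              ring
          _ = _ := one_mul _
  · refine (lintegral_mono fun ω => hcap _ _).trans ?_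
    rw [setLIntegral_const]
    rfl

/-- A light distribution passes the test after an accurate calibration with small probability. -/
theorem IsBag.measure_light_accepted_le (h : IsBag P α θ₀ θ₁ ξ X) (hα : 0 < α) (hα' : α < 1)
    (hθ : θ₀ < θ₁) {e A B : ℝ} (he : 0 < e)
    {k m s i : ℕ} (hi : i ∉ Set.Ico s (s + 5)) :
    P {ω | (Calibrated θ₀ θ₁ (e / 4) k s fun i => draw ξ X i ω) ∧ ξ i ω = false ∧
        (testArm A B (lightEstimate k (fun i j => X i j ω) s + e / 2)
        (fun j => X i j ω) m 0 0).1 = true} ≤ ENNReal.ofReal (Real.exp (-(2 * e * B))) := by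
  have hEm := measurableSet_calibrated θ₀ θ₁ (e / 4) k s
  have hEm' : MeasurableSet {ω | Calibrated θ₀ θ₁ (e / 4) k s fun i => draw ξ X i ω} :=
    h.measurable_draws hEm
  let φ (p : Bool × (Bool × ℕ)) : ENNReal := if p.1 = false ∧ p.2.1 = true then 1 else 0
  have hφ : Measurable φ := Measurable.of_discrete
  have hf : Measurable (Function.uncurry fun (g : ℝ) (y : ℕ → Bool × (ℕ → ℝ)) =>
      φ ((y i).1, testArm A B (g + e / 2) (y i).2 m 0 0)) := by
    have hp : Measurable fun p : ℝ × (ℕ → Bool × (ℕ → ℝ)) => (p.2 i).1 := by fun_prop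
    exact hφ.comp (hp.prodMk (measurable_uncurry_testArm A B (e / 2) m i))
  have hmain := h.lintegral_calibrated_le (k := k) (s := s) (T := {i})
      (by simpa using hi)
      hEm (dependsOn_calibrated θ₀ θ₁ (e / 4) k s) hf
      (fun g y z hyz => by simp only [hyz i rfl]) (K := ENNReal.ofReal (Real.exp (-(2 * e * B))))
      (fun y hy => by
        have hg1 := le_lightEstimate_of_calibrated hθ.le hy
        set g := lightEstimate k (fun i => (y i).2) s
        refine (h.lintegral_eq i fun b ω => φ (b, testArm A B (g + e / 2) (draw ξ X i ω).2 m 0 0)).trans_le ?_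
        have := h.isProbabilityMeasure_cond hα hα' i
        have hl := measure_testArm_true_le_of_light (A := A) (B := B) (γ := g + e / 2)
          (h.indep_samples i false) (h.measurable_sample i)
          (fun j => h.sample_mem_cond i j false) (h.mean_light i) he.le (by linarith) m
        simp only [φ, reduceCtorEq, false_and, if_false, lintegral_zero, mul_zero, zero_add,
          true_and]
        exact (mul_le_of_le_one_left' (ENNReal.ofReal_le_one.2 (by linarith))).trans hl)
  refine le_trans ?_ hmain
  have hfω : Measurable fun ω => φ ((draw ξ X i ω).1,
      testArm A B (lightEstimate k (fun i j => X i j ω) s + e / 2) (draw ξ X i ω).2 m 0 0) := by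
    have hp : Measurable fun ω =>
        (lightEstimate k (fun i j => X i j ω) s, fun i => draw ξ X i ω) :=
      ((measurable_lightEstimate k s).comp h.measurable_draws).prodMk h.measurable_draws
    exact hf.comp hp
  rw [← lintegral_indicator hEm']
  refine le_trans (measure_mono ?_)
    (meas_ge_le_lintegral_div (hfω.indicator hEm').aemeasurable one_ne_zero ENNReal.one_ne_top
      |>.trans_eq (div_one _))
  rintro ω ⟨h1, h2, h3⟩
  rw [Set.mem_ofPred_eq, Set.indicator_of_mem (by exact h1)]
  simp [φ, draw, h2, h3]

/-- If the gap is at least `e`, all `n` tested distributions are rejected with small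
probability. -/
theorem IsBag.measure_all_rejected_le (h : IsBag P α θ₀ θ₁ ξ X) (hα : 0 < α) (hα' : α < 1)
    {e A B : ℝ} (he : 0 < e) (hgap : e ≤ θ₁ - θ₀) (hB : 0 ≤ B)
    {k m s : ℕ} (n : ℕ)
    (hrej : Real.exp (2 * e * A) + Real.exp (e / 2 * B - 3 * e ^ 2 / 32 * m) ≤ 1 / 4) :
    P {ω | ∀ i, s + 5 ≤ i → i < s + 5 + n →
        (testArm A B (lightEstimate k (fun i j => X i j ω) s + e / 2)
        (fun j => X i j ω) m 0 0).1 = false} ≤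
      P {ω | ¬ Calibrated θ₀ θ₁ (e / 4) k s fun i => draw ξ X i ω} +
        ENNReal.ofReal (α ^ 5) + ENNReal.ofReal ((1 - 3 / 4 * α) ^ n) := by
  classical
  -- An accurately measured light distribution keeps the centre below `θ₀ + 3 e / 4 ≤ θ₁ - e / 4`.
  -- If all five are heavy this fails, at the price `α ^ 5`.
  let E (y : ℕ → Bool × (ℕ → ℝ)) : Prop :=
    Calibrated θ₀ θ₁ (e / 4) k s y ∧ ∃ i : Fin 5, (y (s + i)).1 = false
  have hEm : MeasurableSet {y | E y} := by
    have hex : MeasurableSet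
        {y : ℕ → Bool × (ℕ → ℝ) | ∃ i : Fin 5, (y (s + i)).1 = false} := by
      rw [Set.ofPred_exists]
      refine MeasurableSet.iUnion fun i => ?_
      have : Measurable fun y : ℕ → Bool × (ℕ → ℝ) => (y (s + i)).1 := by fun_prop
      exact this (measurableSet_singleton false)
    exact (measurableSet_calibrated θ₀ θ₁ (e / 4) k s).inter hex
  have dE : DependsOn E (Set.Ico s (s + 5)) := by
    intro y z hyz
    have : ∀ i : Fin 5, y (s + i) = z (s + i) := fun i => hyz _ ⟨by omega, by omega⟩
    simp only [E, this, dependsOn_calibrated θ₀ θ₁ (e / 4) k s hyz]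
  have hEm' : MeasurableSet {ω | E fun i => draw ξ X i ω} := h.measurable_draws hEm
  let I := Finset.Ico (s + 5) (s + 5 + n)
  let φ (p : Bool × ℕ) : ENNReal := if p.1 = false then 1 else 0
  have hφ : Measurable φ := Measurable.of_discrete
  have hf : Measurable (Function.uncurry fun (g : ℝ) (y : ℕ → Bool × (ℕ → ℝ)) =>
      ∏ i ∈ I, φ (testArm A B (g + e / 2) (y i).2 m 0 0)) := by
    refine Finset.measurable_prod I fun i _ => ?_
    exact hφ.comp (measurable_uncurry_testArm A B (e / 2) m i)
  have hmain := h.lintegral_calibrated_le (k := k) (s := s) (T := I)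
      (by rw [Set.disjoint_left]; intro i h1 h2; simp [I] at h1 h2; omega)
      hEm dE hf
      (fun g y z hyz => Finset.prod_congr rfl fun i hi => by rw [hyz i hi])
      (K := ENNReal.ofReal ((1 - 3 / 4 * α) ^ n))
      (fun y hy => by
        obtain ⟨i₀, hi₀⟩ := hy.2
        have hg2 := lightEstimate_le_of_calibrated hy.1 i₀
        rw [hi₀, show kindMean θ₀ θ₁ false = θ₀ from rfl] at hg2
        set g := lightEstimate k (fun i => (y i).2) s
        have hmt : ∀ i : ℕ, Measurable fun z : Bool × (ℕ → ℝ) =>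
            φ (testArm A B (g + e / 2) z.2 m 0 0) := by
          intro i
          have hp : Measurable fun z : Bool × (ℕ → ℝ) => ((g + e / 2, z.2), (0 : ℝ)) := by
            fun_prop
          exact hφ.comp ((measurable_testArm A B m 0).comp hp)
        have hind : iIndepFun (fun i ω => φ (testArm A B (g + e / 2) (draw ξ X i ω).2 m 0 0)) P :=
          h.iIndepFun_draw.comp _ hmt
        have hprod : ∫⁻ ω, ∏ i ∈ I, φ (testArm A B (g + e / 2) (draw ξ X i ω).2 m 0 0) ∂P =
            ∏ i ∈ I, ∫⁻ ω, φ (testArm A B (g + e / 2) (draw ξ X i ω).2 m 0 0) ∂P := by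
          exact lintegral_prod_eq_prod_lintegral_of_indepFun I _ hind
            fun i => (hmt i).comp (h.measurable_draw i)
        rw [hprod, ENNReal.ofReal_pow (by linarith)]
        -- With the centre frozen the tests are independent, and each rejects with probability at
        -- most `α / 4 + (1 - α)`.
        refine (Finset.prod_le_pow_card _ _ (ENNReal.ofReal (1 - 3 / 4 * α)) fun i _ => ?_).trans_eq
          (by simp [I])
        rw [h.lintegral_eq i fun _ ω => φ (testArm A B (g + e / 2) (draw ξ X i ω).2 m 0 0)]
        have := h.isProbabilityMeasure_cond hα hα' i
        have hl := measure_testArm_false_le_of_heavy (A := A) (B := B) (γ := g + e / 2)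
          (h.indep_samples i true) (h.measurable_sample i)
          (fun j => h.sample_mem_cond i j true) (h.mean_heavy i) he.le hB (by linarith) m
        have h4 := hl.trans (ENNReal.ofReal_le_ofReal hrej)
        have h1 : ∫⁻ ω, φ (testArm A B (g + e / 2) (draw ξ X i ω).2 m 0 0)
            ∂(ProbabilityTheory.cond P (ξ i ⁻¹' {false})) ≤ 1 := by
          refine (lintegral_mono (g := fun _ => 1) fun ω => ?_).trans (by simp)
          simp only [φ]
          split_ifs <;> simp
        refine (add_le_add (mul_le_mul_right h4 _) (mul_le_mul_right h1 _)).trans_eq ?_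
        rw [← ENNReal.ofReal_mul hα.le, mul_one, ← ENNReal.ofReal_add (by positivity) (by linarith)]
        congr 1
        ring)
  have hheavy : P {ω | ∀ i : Fin 5, ξ (s + i) ω = true} ≤ ENNReal.ofReal (α ^ 5) := by
    have hind : iIndepFun (fun i : Fin 5 => draw ξ X (s + i)) P :=
      h.iIndepFun_draw.precomp (g := fun i : Fin 5 => s + (i : ℕ)) fun a b hab => by
        simpa [Fin.ext_iff] using hab
    have := hind.meas_iInter (s := fun i : Fin 5 => {ω | ξ (s + i) ω = true}) fun i =>
      ⟨Prod.fst ⁻¹' {true}, measurable_fst (measurableSet_singleton true), rfl⟩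
    rw [Set.ofPred_forall, this, ENNReal.ofReal_pow hα.le]
    refine (Finset.prod_congr rfl fun (i : Fin 5) _ => h.measure_heavy (s + i)).trans_le ?_
    simp
  have hrest : P {ω | (E fun i => draw ξ X i ω) ∧ ∀ i, s + 5 ≤ i → i < s + 5 + n →
        (testArm A B (lightEstimate k (fun i j => X i j ω) s + e / 2)
        (fun j => X i j ω) m 0 0).1 = false} ≤ ENNReal.ofReal ((1 - 3 / 4 * α) ^ n) := by
    refine le_trans ?_ hmain
    have hfω : Measurable fun ω => ∏ i ∈ I, φ (
        testArm A B (lightEstimate k (fun i j => X i j ω) s + e / 2) (draw ξ X i ω).2 m 0 0) := by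
      have hp : Measurable fun ω =>
          (lightEstimate k (fun i j => X i j ω) s, fun i => draw ξ X i ω) :=
        ((measurable_lightEstimate k s).comp h.measurable_draws).prodMk h.measurable_draws
      exact hf.comp hp
    rw [← lintegral_indicator hEm']
    refine le_trans (measure_mono ?_)
      (meas_ge_le_lintegral_div (hfω.indicator hEm').aemeasurable one_ne_zero ENNReal.one_ne_top
        |>.trans_eq (div_one _))
    rintro ω ⟨h1, h2⟩
    rw [Set.mem_ofPred_eq, Set.indicator_of_mem (by exact h1)]
    refine (Finset.prod_eq_one fun i hi => ?_).ge
    obtain ⟨h3, h4⟩ := Finset.mem_Ico.1 hi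
    simp only [φ, draw]
    rw [if_pos (h2 i h3 h4)]
  refine le_trans (measure_mono ?_) ((measure_union_le _ _).trans (add_le_add
    ((measure_union_le _ _).trans (add_le_add le_rfl hheavy)) hrest))
  intro ω hω
  by_cases h1 : Calibrated θ₀ θ₁ (e / 4) k s fun i => draw ξ X i ω
  · by_cases h2 : ∀ i : Fin 5, ξ (s + i) ω = true
    · exact Or.inl (Or.inr h2)
    · refine Or.inr ⟨⟨h1, ?_⟩, hω⟩
      simpa [draw] using h2
  · exact Or.inl (Or.inl h1)

end Bag

/-! ### What the choices of `n`, `m`, `B` and `k₂` guarantee. -/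

section Parameters

theorem log_nine_gt : 2 < Real.log 9 := by
  rw [Real.lt_log_iff_exp_lt (by norm_num)]
  have h := Real.exp_one_lt_d9
  have e : Real.exp 2 = Real.exp 1 ^ 2 := by rw [← Real.exp_nat_mul]; norm_num
  rw [e]
  have h0 := Real.exp_pos 1
  nlinarith

theorem one_lt_log_fourteen : 1 < Real.log 14 := by
  rw [Real.lt_log_iff_exp_lt (by norm_num)]
  linarith [Real.exp_one_lt_d9]

theorem log_twentyone_le : Real.log 21 ≤ 4 := by
  rw [Real.log_le_iff_le_exp (by norm_num)]
  have h := Real.exp_one_gt_d9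
  have e : Real.exp 4 = (Real.exp 1 ^ 2) ^ 2 := by rw [← pow_mul, ← Real.exp_nat_mul]; norm_num
  have h2 : 7 ≤ Real.exp 1 ^ 2 := by nlinarith
  rw [e]
  nlinarith

variable {α₀ ε₀ δ : ℝ}

theorem le_numArms_mul (hα : 0 < α₀) : 2 * Real.log 9 ≤ numArms α₀ * α₀ :=
  (div_le_iff₀ hα).1 (Nat.le_ceil _)

theorem one_le_numArms (hα : 0 < α₀) : 1 ≤ numArms α₀ :=
  Nat.one_le_ceil_iff.2 (div_pos (by linarith [log_nine_gt]) hα)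

/-- `log (14 n / δ)`. -/
def logTerm (α₀ δ : ℝ) : ℝ := Real.log (14 * numArms α₀ / δ)

theorem exp_neg_logTerm (hα : 0 < α₀) (hδ : 0 < δ) :
    Real.exp (-logTerm α₀ δ) = δ / (14 * numArms α₀) := by
  have : (1 : ℝ) ≤ numArms α₀ := by exact_mod_cast one_le_numArms hα
  rw [logTerm, Real.exp_neg, Real.exp_log (by positivity), inv_div]

theorem one_lt_logTerm (hα : 0 < α₀) (hδ : 0 < δ) (hδ' : δ ≤ 1) : 1 < logTerm α₀ δ := by
  have : (1 : ℝ) ≤ numArms α₀ := by exact_mod_cast one_le_numArms hα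
  refine one_lt_log_fourteen.trans_le (Real.log_le_log (by norm_num) ?_)
  rw [le_div_iff₀ hδ]
  nlinarith

theorem upperThreshold_eq : upperThreshold α₀ ε₀ δ = 8 * ε₀⁻¹ * logTerm α₀ δ := rfl

theorem le_maxSamples : 64 * (ε₀ ^ 2)⁻¹ * logTerm α₀ δ ≤ maxSamples α₀ ε₀ δ := Nat.le_ceil _

theorem maxSamples_pos (hα : 0 < α₀) (he : 0 < ε₀) (hδ : 0 < δ) (hδ' : δ ≤ 1) :
    (0 : ℝ) < maxSamples α₀ ε₀ δ := by
  have := one_lt_logTerm hα hδ hδ'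
  exact lt_of_lt_of_le (by positivity) le_maxSamples

/-- The failure probability that the calibration aims at. -/
def calibrationError (α₀ ε₀ δ : ℝ) : ℝ :=
  min (δ / 8) ((maxSamples α₀ ε₀ δ : ℝ)⁻¹ * (ε₀ ^ 2)⁻¹)

theorem calibrationError_pos (hα : 0 < α₀) (he : 0 < ε₀) (hδ : 0 < δ) (hδ' : δ ≤ 1) :
    0 < calibrationError α₀ ε₀ δ := by
  have := maxSamples_pos hα he hδ hδ'
  exact lt_min (by positivity) (by positivity)

theorem le_calibrationSamples :
    8 * (ε₀ ^ 2)⁻¹ * Real.log (10 / calibrationError α₀ ε₀ δ) ≤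
      calibrationSamples α₀ ε₀ δ := by
  refine le_trans (le_of_eq ?_) (Nat.le_ceil _)
  rw [calibrationError]
  norm_num

theorem calibrationSamples_pos (hα : 0 < α₀) (he : 0 < ε₀) (hδ : 0 < δ) (hδ' : δ ≤ 1) :
    0 < calibrationSamples α₀ ε₀ δ := by
  have h0 := calibrationError_pos hα he hδ hδ'
  have h1 : calibrationError α₀ ε₀ δ ≤ δ / 8 := min_le_left _ _
  have : 0 < Real.log (10 / calibrationError α₀ ε₀ δ) :=
    Real.log_pos ((one_lt_div h0).2 (by linarith))
  have h2 : (0 : ℝ) < calibrationSamples α₀ ε₀ δ :=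
    lt_of_lt_of_le (by positivity) le_calibrationSamples
  exact_mod_cast h2

theorem exp_calibrationSamples_le (hα : 0 < α₀) (he : 0 < ε₀) (hδ : 0 < δ) (hδ' : δ ≤ 1) :
    10 * Real.exp (-(2 * calibrationSamples α₀ ε₀ δ * (ε₀ / 4) ^ 2)) ≤
      calibrationError α₀ ε₀ δ := by
  have h0 := calibrationError_pos hα he hδ hδ'
  have h1 := le_calibrationSamples (α₀ := α₀) (ε₀ := ε₀) (δ := δ)
  have h2 : Real.log (10 / calibrationError α₀ ε₀ δ) ≤
      2 * calibrationSamples α₀ ε₀ δ * (ε₀ / 4) ^ 2 := by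
    calc _ = (8 * (ε₀ ^ 2)⁻¹ * Real.log (10 / calibrationError α₀ ε₀ δ)) * (ε₀ ^ 2 / 8) := by
          field_simp
      _ ≤ calibrationSamples α₀ ε₀ δ * (ε₀ ^ 2 / 8) := by gcongr
      _ = _ := by ring
  calc _ ≤ 10 * Real.exp (-Real.log (10 / calibrationError α₀ ε₀ δ)) := by gcongr
    _ = _ := by
      rw [Real.exp_neg, Real.exp_log (by positivity)]
      field_simp

end Parameters

/-! ### One run of the subroutine with its actual parameters. -/

section Run

variable {α₀ ε₀ δ : ℝ}

/-- An upper bound for the number of samples of a run: all distributions are tested. -/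
def runCost (α₀ ε₀ δ : ℝ) (x : ℕ → ℕ → ℝ) (s : ℕ) : ℕ :=
  5 * calibrationSamples α₀ ε₀ δ + ∑ h ∈ Finset.range (numArms α₀),
    (testArm (lowerThreshold ε₀) (upperThreshold α₀ ε₀ δ)
      (lightEstimate (calibrationSamples α₀ ε₀ δ) x s + ε₀ / 2) (x (s + 5 + h))
      (maxSamples α₀ ε₀ δ) 0 0).2

theorem boundedSearch_samples_le (x : ℕ → ℕ → ℝ) (s : ℕ) :
    (boundedSearch α₀ ε₀ δ x s).samples ≤ runCost α₀ ε₀ δ x s := searchArms_samples_le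

theorem boundedSearch_output_eq_none_iff {x : ℕ → ℕ → ℝ} {s : ℕ} :
    (boundedSearch α₀ ε₀ δ x s).output = none ↔
      ∀ h, s + 5 ≤ h → h < s + 5 + numArms α₀ →
        (testArm (lowerThreshold ε₀) (upperThreshold α₀ ε₀ δ)
          (lightEstimate (calibrationSamples α₀ ε₀ δ) x s + ε₀ / 2) (x h)
          (maxSamples α₀ ε₀ δ) 0 0).1 = false := searchArms_output_eq_none_iff

theorem boundedSearch_nextArm {x : ℕ → ℕ → ℝ} {s : ℕ}
    (h : (boundedSearch α₀ ε₀ δ x s).output = none) :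
    (boundedSearch α₀ ε₀ δ x s).nextArm = s + 5 + numArms α₀ :=
  searchArms_nextArm_of_output_eq_none h

theorem measurable_testArm_lightEstimate (A B c : ℝ) (k m s i : ℕ) :
    Measurable fun y : ℕ → Bool × (ℕ → ℝ) =>
      testArm A B (lightEstimate k (fun i => (y i).2) s + c) (y i).2 m 0 0 := by
  have hp : Measurable fun y : ℕ → Bool × (ℕ → ℝ) => (lightEstimate k (fun i => (y i).2) s, y) :=
    (measurable_lightEstimate k s).prodMk measurable_id
  exact (measurable_uncurry_testArm A B c m i).comp hp

theorem measurable_runCost (s : ℕ) :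
    Measurable fun y : ℕ → Bool × (ℕ → ℝ) => runCost α₀ ε₀ δ (fun i => (y i).2) s := by
  refine measurable_const.add (Finset.measurable_sum _ fun h _ => ?_)
  exact measurable_snd.comp (measurable_testArm_lightEstimate _ _ _ _ _ _ _)

theorem measurableSet_boundedSearch_eq_none (s : ℕ) :
    MeasurableSet {y : ℕ → Bool × (ℕ → ℝ) |
      (boundedSearch α₀ ε₀ δ (fun i => (y i).2) s).output = none} := by
  simp only [boundedSearch_output_eq_none_iff, Set.ofPred_forall]
  refine MeasurableSet.iInter fun h => MeasurableSet.iInter fun _ => MeasurableSet.iInter fun _ => ?_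
  exact (measurable_fst.comp (measurable_testArm_lightEstimate _ _ _ _ _ _ _))
    (measurableSet_singleton false)

theorem dependsOn_runCost (s : ℕ) :
    DependsOn (fun y : ℕ → Bool × (ℕ → ℝ) => runCost α₀ ε₀ δ (fun i => (y i).2) s)
      {i | s ≤ i} := by
  intro y z hyz
  have h1 := dependsOn_lightEstimate (calibrationSamples α₀ ε₀ δ) s
    (fun i hi => hyz i hi.1 : ∀ i ∈ Set.Ico s (s + 5), y i = z i)
  simp only at h1
  simp only [runCost, h1]
  congr 1
  refine Finset.sum_congr rfl fun h _ => ?_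
  rw [hyz (s + 5 + h) (by simp only [Set.mem_ofPred_eq]; omega)]

theorem dependsOn_boundedSearch_eq_none (s : ℕ) :
    DependsOn (fun y : ℕ → Bool × (ℕ → ℝ) =>
      (boundedSearch α₀ ε₀ δ (fun i => (y i).2) s).output = none)
      (Set.Ico s (s + 5 + numArms α₀)) := by
  intro y z hyz
  have h1 := dependsOn_lightEstimate (calibrationSamples α₀ ε₀ δ) s
    (fun i hi => hyz i ⟨hi.1, by have := hi.2; omega⟩ : ∀ i ∈ Set.Ico s (s + 5), y i = z i)
  simp only at h1
  simp only [boundedSearch_output_eq_none_iff, h1, eq_iff_iff]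
  refine forall_congr' fun h => forall_congr' fun h2 => forall_congr' fun h3 => ?_
  rw [hyz h ⟨by omega, h3⟩]

variable {Ω : Type*} [MeasurableSpace Ω] {P : Measure Ω} [IsProbabilityMeasure P]
  {α θ₀ θ₁ : ℝ} {ξ : ℕ → Ω → Bool} {X : ℕ → ℕ → Ω → ℝ}

theorem IsBag.measure_not_calibrated_le_error (h : IsBag P α θ₀ θ₁ ξ X) (hα : 0 < α)
    (hα' : α < 1) (hα₀ : 0 < α₀) (he : 0 < ε₀) (hδ : 0 < δ) (hδ' : δ ≤ 1) (s : ℕ) :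
    P {ω | ¬ Calibrated θ₀ θ₁ (ε₀ / 4) (calibrationSamples α₀ ε₀ δ) s fun i => draw ξ X i ω} ≤
      ENNReal.ofReal (calibrationError α₀ ε₀ δ) :=
  (h.measure_not_calibrated_le hα hα' (calibrationSamples_pos hα₀ he hδ hδ') (by positivity)
    s).trans (ENNReal.ofReal_le_ofReal (exp_calibrationSamples_le hα₀ he hδ hδ'))

theorem IsBag.lintegral_runCost_le (h : IsBag P α θ₀ θ₁ ξ X) (hα : 0 < α) (hα' : α < 1)
    (hθ : θ₀ < θ₁) (hθ₁ : θ₁ ≤ 1) (hα₀ : 0 < α₀) (he : 0 < ε₀) (he' : ε₀ ≤ 1)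
    (hδ : 0 < δ) (hδ' : δ ≤ 1) (s : ℕ) :
    ∫⁻ ω, (runCost α₀ ε₀ δ (fun i j => X i j ω) s : ENNReal) ∂P ≤
      ENNReal.ofReal (5 * calibrationSamples α₀ ε₀ δ + numArms α₀ *
        (maxSamples α₀ ε₀ δ * α + 140 * (ε₀ ^ 2)⁻¹)) := by
  have hlog : 0 < Real.log 21 := Real.log_pos (by norm_num)
  have hA : lowerThreshold ε₀ ≤ 0 := by
    have : 0 < 8 * ε₀⁻¹ * Real.log 21 := by positivity
    simp only [lowerThreshold]
    linarith
  have hm0 := maxSamples_pos hα₀ he hδ hδ'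
  have hcal := h.measure_not_calibrated_le_error hα hα' hα₀ he hδ hδ' s
  have hC0 := calibrationError_pos hα₀ he hδ hδ'
  have hone : ∀ i, s + 5 ≤ i → ∫⁻ ω, ((testArm (lowerThreshold ε₀) (upperThreshold α₀ ε₀ δ)
      (lightEstimate (calibrationSamples α₀ ε₀ δ) (fun i j => X i j ω) s + ε₀ / 2)
      (fun j => X i j ω) (maxSamples α₀ ε₀ δ) 0 0).2 : ENNReal) ∂P ≤
      ENNReal.ofReal (maxSamples α₀ ε₀ δ * α + 140 * (ε₀ ^ 2)⁻¹) := by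
    intro i hi
    refine (h.lintegral_samples_le hα hα' hθ hθ₁ he he' hA
      (by simp only [Set.mem_Ico]; omega)).trans ?_
    refine (add_le_add_left (add_le_add_right (mul_le_mul_right hcal _) _) _).trans ?_
    have hL : 0 ≤ (2 - lowerThreshold ε₀) / (ε₀ / 4) := div_nonneg (by linarith) (by positivity)
    rw [← ENNReal.ofReal_natCast, ← ENNReal.ofReal_mul hm0.le, ← ENNReal.ofReal_mul hm0.le,
      ← ENNReal.ofReal_add (by positivity) (by positivity),
      ← ENNReal.ofReal_add (by positivity) hL]
    refine ENNReal.ofReal_le_ofReal ?_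
    -- This is the purpose of the second entry of the minimum in `calibrationError`: a failed
    -- calibration costs no more in mean than a light test.
    have h1 : maxSamples α₀ ε₀ δ * calibrationError α₀ ε₀ δ ≤ (ε₀ ^ 2)⁻¹ :=
      (mul_le_mul_of_nonneg_left (min_le_right _ _) hm0.le).trans_eq
        (mul_inv_cancel_left₀ hm0.ne' _)
    have h2 : (2 - lowerThreshold ε₀) / (ε₀ / 4) ≤ 136 * (ε₀ ^ 2)⁻¹ := by
      have e : (2 - lowerThreshold ε₀) / (ε₀ / 4) = (8 * ε₀ + 32 * Real.log 21) * (ε₀ ^ 2)⁻¹ := by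
        simp only [lowerThreshold]
        field_simp
        ring
      rw [e]
      refine mul_le_mul_of_nonneg_right ?_ (by positivity)
      linarith [log_twentyone_le]
    have h3 : 0 < (ε₀ ^ 2)⁻¹ := by positivity
    linarith
  have hmeas : ∀ i, Measurable fun ω => ((testArm (lowerThreshold ε₀) (upperThreshold α₀ ε₀ δ)
      (lightEstimate (calibrationSamples α₀ ε₀ δ) (fun i j => X i j ω) s + ε₀ / 2)
      (fun j => X i j ω) (maxSamples α₀ ε₀ δ) 0 0).2 : ENNReal) := by
    intro i
    have h1 : Measurable fun p : Bool × ℕ => (p.2 : ENNReal) := Measurable.of_discrete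
    have h2 := (measurable_testArm_lightEstimate (lowerThreshold ε₀) (upperThreshold α₀ ε₀ δ)
      (ε₀ / 2) (calibrationSamples α₀ ε₀ δ) (maxSamples α₀ ε₀ δ) s i).comp h.measurable_draws
    exact h1.comp h2
  simp only [runCost, Nat.cast_add, Nat.cast_sum]
  rw [lintegral_add_left measurable_const, lintegral_finsetSum _ fun i _ => hmeas _,
    lintegral_const, measure_univ, mul_one, ENNReal.ofReal_add (by positivity) (by positivity)]
  refine add_le_add (le_of_eq ?_) ((Finset.sum_le_card_nsmul _ _ _ fun i _ =>
    hone (s + 5 + i) (by omega)).trans_eq ?_)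
  · rw [← ENNReal.ofReal_natCast]
    push_cast
    rfl
  · rw [Finset.card_range, nsmul_eq_mul, ENNReal.ofReal_mul (by positivity),
      ENNReal.ofReal_natCast]

/-- A failed calibration contributes `δ / 8`, the `n` tests together `δ / 14`. The guesses `α₀`,
`ε₀` need not be related to the true parameters, so runs at bad landmarks are safe. -/
theorem IsBag.measure_light_output_le (h : IsBag P α θ₀ θ₁ ξ X) (hα : 0 < α) (hα' : α < 1)
    (hθ : θ₀ < θ₁) (hα₀ : 0 < α₀) (he : 0 < ε₀) (hδ : 0 < δ) (hδ' : δ ≤ 1) (s : ℕ) :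
    P {ω | ∃ i, (boundedSearch α₀ ε₀ δ (fun i j => X i j ω) s).output = some i ∧
      ξ i ω = false} ≤ ENNReal.ofReal (δ / 4) := by
  have hcal := h.measure_not_calibrated_le_error hα hα' hα₀ he hδ hδ' s
  have hL := one_lt_logTerm hα₀ hδ hδ'
  have hn : (1 : ℝ) ≤ numArms α₀ := by exact_mod_cast one_le_numArms hα₀
  have hone : ∀ i, s + 5 ≤ i → P {ω |
      (Calibrated θ₀ θ₁ (ε₀ / 4) (calibrationSamples α₀ ε₀ δ) s fun i => draw ξ X i ω) ∧
      ξ i ω = false ∧ (testArm (lowerThreshold ε₀) (upperThreshold α₀ ε₀ δ)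
      (lightEstimate (calibrationSamples α₀ ε₀ δ) (fun i j => X i j ω) s + ε₀ / 2)
      (fun j => X i j ω) (maxSamples α₀ ε₀ δ) 0 0).1 = true} ≤
        ENNReal.ofReal (δ / (14 * numArms α₀)) := by
    intro i hi
    refine (h.measure_light_accepted_le hα hα' hθ he
      (by simp only [Set.mem_Ico]; omega)).trans (ENNReal.ofReal_le_ofReal ?_)
    rw [← exp_neg_logTerm hα₀ hδ, Real.exp_le_exp, upperThreshold_eq]
    have : 2 * ε₀ * (8 * ε₀⁻¹ * logTerm α₀ δ) = 16 * logTerm α₀ δ := by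
      field_simp
      ring
    rw [this]
    linarith
  have hsub : {ω | ∃ i, (boundedSearch α₀ ε₀ δ (fun i j => X i j ω) s).output = some i ∧
      ξ i ω = false} ⊆
      {ω | ¬ Calibrated θ₀ θ₁ (ε₀ / 4) (calibrationSamples α₀ ε₀ δ) s fun i => draw ξ X i ω} ∪
      ⋃ i ∈ Finset.range (numArms α₀), {ω |
      (Calibrated θ₀ θ₁ (ε₀ / 4) (calibrationSamples α₀ ε₀ δ) s fun i => draw ξ X i ω) ∧
      ξ (s + 5 + i) ω = false ∧ (testArm (lowerThreshold ε₀) (upperThreshold α₀ ε₀ δ)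
      (lightEstimate (calibrationSamples α₀ ε₀ δ) (fun i j => X i j ω) s + ε₀ / 2)
      (fun j => X (s + 5 + i) j ω) (maxSamples α₀ ε₀ δ) 0 0).1 = true} := by
    rintro ω ⟨i, h1, h2⟩
    by_cases hc : Calibrated θ₀ θ₁ (ε₀ / 4) (calibrationSamples α₀ ε₀ δ) s fun i => draw ξ X i ω
    · right
      obtain ⟨h3, h4, h5⟩ := searchArms_output_eq_some h1
      obtain ⟨d, rfl⟩ := Nat.exists_eq_add_of_le h3
      exact Set.mem_biUnion (x := d) (by simp; omega) ⟨hc, h2, h5⟩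
    · exact Or.inl hc
  refine (measure_mono hsub).trans ((measure_union_le _ _).trans ((add_le_add hcal
    ((measure_biUnion_finset_le _ _).trans (Finset.sum_le_card_nsmul _ _ _ fun i _ =>
      hone (s + 5 + i) (by omega)))).trans ?_))
  rw [Finset.card_range, nsmul_eq_mul, ← ENNReal.ofReal_natCast,
    ← ENNReal.ofReal_mul (by positivity),
    ← ENNReal.ofReal_add (calibrationError_pos hα₀ he hδ hδ').le (by positivity)]
  refine ENNReal.ofReal_le_ofReal ?_
  have h1 : calibrationError α₀ ε₀ δ ≤ δ / 8 := min_le_left _ _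
  have h2 : numArms α₀ * (δ / (14 * numArms α₀)) = δ / 14 := by field_simp
  linarith

/-- Failed calibration, five heavy calibrators and rejection of every tested distribution contribute
at most `1 / 16 + 1 / 32 + 1 / 9 < 1 / 4`. -/
theorem IsBag.measure_null_le (h : IsBag P α θ₀ θ₁ ξ X) (hα : 0 < α) (hα' : α ≤ 1 / 2)
    (hα₀ : 0 < α₀) (hαα : α₀ ≤ α) (he : 0 < ε₀) (hgap : ε₀ ≤ θ₁ - θ₀)
    (hδ : 0 < δ) (hδ' : δ ≤ 1 / 2) (s : ℕ) :
    P {ω | (boundedSearch α₀ ε₀ δ (fun i j => X i j ω) s).output = none} ≤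
      ENNReal.ofReal (1 / 4) := by
  have hcal := h.measure_not_calibrated_le_error hα (by linarith) hα₀ he hδ (by linarith) s
  have hL := one_lt_logTerm hα₀ hδ (by linarith)
  have hn : (1 : ℝ) ≤ numArms α₀ := by exact_mod_cast one_le_numArms hα₀
  have hB : 0 ≤ upperThreshold α₀ ε₀ δ := by rw [upperThreshold_eq]; positivity
  have hrej : Real.exp (2 * ε₀ * lowerThreshold ε₀) +
      Real.exp (ε₀ / 2 * upperThreshold α₀ ε₀ δ -
        3 * ε₀ ^ 2 / 32 * maxSamples α₀ ε₀ δ) ≤ 1 / 4 := by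
    have h21 : 0 < Real.log 21 := Real.log_pos (by norm_num)
    have h1 : Real.exp (2 * ε₀ * lowerThreshold ε₀) ≤ 1 / 21 := by
      have : 2 * ε₀ * lowerThreshold ε₀ = -(16 * Real.log 21) := by
        simp only [lowerThreshold]
        field_simp
        ring
      rw [this]
      calc _ ≤ Real.exp (-Real.log 21) := Real.exp_le_exp.2 (by linarith)
        _ = _ := by rw [Real.exp_neg, Real.exp_log (by norm_num)]; norm_num
    have h2 : Real.exp (ε₀ / 2 * upperThreshold α₀ ε₀ δ -
        3 * ε₀ ^ 2 / 32 * maxSamples α₀ ε₀ δ) ≤ 1 / 14 := by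
      have h3 : ε₀ / 2 * upperThreshold α₀ ε₀ δ = 4 * logTerm α₀ δ := by
        rw [upperThreshold_eq]
        field_simp
        ring
      have h4 : 6 * logTerm α₀ δ ≤ 3 * ε₀ ^ 2 / 32 * maxSamples α₀ ε₀ δ := by
        calc _ = 3 * ε₀ ^ 2 / 32 * (64 * (ε₀ ^ 2)⁻¹ * logTerm α₀ δ) := by
              field_simp
              ring
          _ ≤ _ := by
            gcongr
            exact le_maxSamples
      calc _ ≤ Real.exp (-logTerm α₀ δ) := Real.exp_le_exp.2 (by linarith)
        _ = δ / (14 * numArms α₀) := exp_neg_logTerm hα₀ hδ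
        _ ≤ 1 / 14 := by
          rw [div_le_div_iff₀ (by positivity) (by norm_num)]
          nlinarith
    linarith
  have hmain := h.measure_all_rejected_le hα (by linarith) he hgap hB
    (k := calibrationSamples α₀ ε₀ δ) (s := s) (numArms α₀) hrej
  simp only [boundedSearch_output_eq_none_iff]
  refine hmain.trans ((add_le_add_left (add_le_add_left hcal _) _).trans ?_)
  have hq : (0 : ℝ) ≤ 1 - 3 / 4 * α := by linarith
  rw [← ENNReal.ofReal_add (calibrationError_pos hα₀ he hδ (by linarith)).le (by positivity),
    ← ENNReal.ofReal_add (add_nonneg (calibrationError_pos hα₀ he hδ (by linarith)).le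
      (by positivity)) (by positivity)]
  refine ENNReal.ofReal_le_ofReal ?_
  have h1 : calibrationError α₀ ε₀ δ ≤ δ / 8 := min_le_left _ _
  have h2 : α ^ 5 ≤ (1 / 2) ^ 5 := pow_le_pow_left₀ hα.le hα' 5
  have h3 : (1 - 3 / 4 * α) ^ numArms α₀ ≤ 1 / 9 := by
    calc _ ≤ (Real.exp (-(3 / 4 * α))) ^ numArms α₀ :=
          pow_le_pow_left₀ hq (Real.one_sub_le_exp_neg _) _
      _ = Real.exp (-(3 / 4 * (numArms α₀ * α))) := by
        rw [← Real.exp_nat_mul]; congr 1; ring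
      _ ≤ Real.exp (-Real.log 9) := by
        refine Real.exp_le_exp.2 (neg_le_neg ?_)
        have h4 := le_numArms_mul hα₀
        have h5 : (numArms α₀ : ℝ) * α₀ ≤ numArms α₀ * α := by gcongr
        linarith [log_nine_gt]
      _ = _ := by rw [Real.exp_neg, Real.exp_log (by norm_num)]; norm_num
  norm_num at h2 ⊢
  linarith

end Run

/-! ### Stages as runs on fixed blocks of indices. -/

section Pathwise

/-- The first distribution used at landmark `k` of stage `l`, if the stage starts at `s`. -/
def loopStart (l s : ℕ) : ℕ → ℕ
  | 0 => s
  | k + 1 => loopStart l s k + 5 + numArms (landmarkAlpha l k)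

/-- The number of distributions used in the stages `1, …, L` if none is declared heavy. -/
def stageStart : ℕ → ℕ
  | 0 => 0
  | L + 1 => loopStart (L + 1) (stageStart L) (L + 2)

theorem le_loopStart (l s : ℕ) : ∀ k, s ≤ loopStart l s k
  | 0 => le_rfl
  | k + 1 => (le_loopStart l s k).trans (by rw [loopStart]; omega)

theorem loopStart_mono (l s : ℕ) : Monotone (loopStart l s) :=
  monotone_nat_of_le_succ fun k => by rw [loopStart]; omega

theorem stageStart_mono : Monotone stageStart :=
  monotone_nat_of_le_succ fun L => by rw [stageStart]; exact le_loopStart _ _ _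

/-- The run at landmark `k` of stage `L + 1`. -/
def landmarkRun (δ : ℝ) (L k : ℕ) (x : ℕ → ℕ → ℝ) : State :=
  boundedSearch (landmarkAlpha (L + 1) k) (landmarkEps (L + 1) k) (stageDelta δ (L + 1)) x
    (loopStart (L + 1) (stageStart L) k)

/-- The bound `runCost` for the run at landmark `k` of stage `L + 1`. -/
def landmarkCost (δ : ℝ) (L k : ℕ) (x : ℕ → ℕ → ℝ) : ℕ :=
  runCost (landmarkAlpha (L + 1) k) (landmarkEps (L + 1) k) (stageDelta δ (L + 1)) x
    (loopStart (L + 1) (stageStart L) k)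

variable {δ : ℝ} {L : ℕ} {x : ℕ → ℕ → ℝ} {s : State}

/-- While nothing has been output, all earlier runs used their full quota of distributions, so the
adaptive loop coincides with the runs `landmarkRun` on predetermined blocks. This is what makes
independence usable. -/
theorem landmarkLoop_eq_none (hs : s.output = none → s.nextArm = stageStart L) (K : ℕ) :
    ((landmarkLoop δ (L + 1) x s K).output = none ↔
      s.output = none ∧ ∀ k < K, (landmarkRun δ L k x).output = none) ∧
    ((landmarkLoop δ (L + 1) x s K).output = none →
      (landmarkLoop δ (L + 1) x s K).nextArm = loopStart (L + 1) (stageStart L) K) := by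
  induction K with
  | zero => simpa [landmarkLoop, loopStart] using hs
  | succ K ih =>
    obtain ⟨ih1, ih2⟩ := ih
    simp only [landmarkLoop]
    by_cases ho : (landmarkLoop δ (L + 1) x s K).output = none
    · have hn := ih2 ho
      obtain ⟨h1, h2⟩ := ih1.1 ho
      simp only [ho, Option.isSome_none, Bool.false_eq_true, if_false, hn]
      refine ⟨⟨fun h => ⟨h1, fun k hk => ?_⟩, fun h => h.2 K (by omega)⟩, fun h => ?_⟩
      · rcases Nat.lt_succ_iff_lt_or_eq.1 hk with hk | rfl
        · exact h2 k hk
        · exact h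
      · rw [boundedSearch_nextArm h, loopStart]
    · have hsome : (landmarkLoop δ (L + 1) x s K).output.isSome = true :=
        Option.isSome_iff_ne_none.2 ho
      simp only [hsome, if_true]
      refine ⟨⟨fun h => absurd h ho, fun h => ?_⟩, fun h => absurd h ho⟩
      exact absurd (ih1.2 ⟨h.1, fun k hk => h.2 k (by omega)⟩) ho

theorem landmarkLoop_samples_le (hs : s.output = none → s.nextArm = stageStart L) (K : ℕ) :
    (landmarkLoop δ (L + 1) x s K).samples ≤
      s.samples + if s.output = none then ∑ k ∈ Finset.range K, landmarkCost δ L k x else 0 := by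
  induction K with
  | zero => simp [landmarkLoop]
  | succ K ih =>
    simp only [landmarkLoop]
    by_cases ho : (landmarkLoop δ (L + 1) x s K).output = none
    · have hn := (landmarkLoop_eq_none hs K).2 ho
      have h1 := ((landmarkLoop_eq_none hs K).1.1 ho).1
      simp only [ho, Option.isSome_none, Bool.false_eq_true, if_false, hn, h1, if_true,
        Finset.sum_range_succ] at ih ⊢
      have := boundedSearch_samples_le (α₀ := landmarkAlpha (L + 1) K)
        (ε₀ := landmarkEps (L + 1) K) (δ := stageDelta δ (L + 1)) x
        (loopStart (L + 1) (stageStart L) K)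
      simp only [landmarkCost] at ih ⊢
      omega
    · have hsome : (landmarkLoop δ (L + 1) x s K).output.isSome = true :=
        Option.isSome_iff_ne_none.2 ho
      simp only [hsome, if_true]
      refine ih.trans ?_
      split_ifs
      · rw [Finset.sum_range_succ]
        omega
      · rfl

theorem landmarkLoop_eq_some (hs : s.output = none → s.nextArm = stageStart L) (K : ℕ) {h : ℕ}
    (H : (landmarkLoop δ (L + 1) x s K).output = some h) :
    s.output = some h ∨ ∃ k < K, (landmarkRun δ L k x).output = some h := by
  induction K with
  | zero => exact Or.inl H
  | succ K ih =>
    simp only [landmarkLoop] at H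
    by_cases ho : (landmarkLoop δ (L + 1) x s K).output = none
    · have hn := (landmarkLoop_eq_none hs K).2 ho
      simp only [ho, Option.isSome_none, Bool.false_eq_true, if_false, hn] at H
      exact Or.inr ⟨K, by omega, H⟩
    · have hsome : (landmarkLoop δ (L + 1) x s K).output.isSome = true :=
        Option.isSome_iff_ne_none.2 ho
      simp only [hsome, if_true] at H
      rcases ih H with h1 | ⟨k, hk, h1⟩
      · exact Or.inl h1
      · exact Or.inr ⟨k, by omega, h1⟩

theorem stages_nextArm :
    ∀ L, (stages δ x L).output = none → (stages δ x L).nextArm = stageStart L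
  | 0, _ => rfl
  | L + 1, h => (landmarkLoop_eq_none (stages_nextArm L) (L + 2)).2 h

theorem stages_succ_eq_none_iff (L : ℕ) : (stages δ x (L + 1)).output = none ↔
    (stages δ x L).output = none ∧ ∀ k < L + 2, (landmarkRun δ L k x).output = none :=
  (landmarkLoop_eq_none (stages_nextArm L) (L + 2)).1

theorem stages_eq_some {h : ℕ} : ∀ L, (stages δ x L).output = some h →
    ∃ L', ∃ k < L' + 2, (landmarkRun δ L' k x).output = some h
  | 0, H => by simp [stages] at H
  | L + 1, H => by
    rcases landmarkLoop_eq_some (stages_nextArm L) (L + 2) H with h1 | ⟨k, hk, h1⟩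
    · exact stages_eq_some L h1
    · exact ⟨L, k, hk, h1⟩

theorem stages_samples_le (L : ℕ) : (stages δ x L).samples ≤ ∑ l ∈ Finset.range L,
    if (stages δ x l).output = none then ∑ k ∈ Finset.range (l + 2), landmarkCost δ l k x
      else 0 := by
  induction L with
  | zero => simp [stages]
  | succ L ih =>
    rw [Finset.sum_range_succ]
    exact (landmarkLoop_samples_le (stages_nextArm L) (L + 2)).trans (by gcongr)

/-- A stage that is entered is charged in full. In each summand the indicator looks at distributions
before the stage, the cost at later ones. -/
theorem totalSamples_le : totalSamples δ x ≤ ∑' l,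
    (if (stages δ x l).output = none then 1 else 0) *
      ∑ k ∈ Finset.range (l + 2), (landmarkCost δ l k x : ENNReal) := by
  refine iSup_le fun L => ?_
  refine le_trans ?_ (ENNReal.sum_le_tsum (Finset.range L))
  refine (Nat.cast_le.2 (stages_samples_le L)).trans_eq ?_
  rw [Nat.cast_sum]
  refine Finset.sum_congr rfl fun l _ => ?_
  split_ifs <;> simp

end Pathwise

/-! ### Survival of the stages and correctness of the output. -/

section Bag

variable {Ω : Type*} [MeasurableSpace Ω] {P : Measure Ω}
  {α θ₀ θ₁ δ : ℝ} {ξ : ℕ → Ω → Bool} {X : ℕ → ℕ → Ω → ℝ}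

theorem landmarkAlpha_pos (l k : ℕ) : 0 < landmarkAlpha l k := by
  simp only [landmarkAlpha, stageGamma]; positivity

theorem landmarkEps_pos (l k : ℕ) : 0 < landmarkEps l k := by
  simp only [landmarkEps, landmarkAlpha, stageGamma]; positivity

theorem landmarkEps_sq (l k : ℕ) : landmarkEps l k ^ 2 = (2 ^ (k + 1))⁻¹ := by
  have h : 2 * landmarkAlpha l k * stageGamma l = 2 ^ (k + 1) := by
    simp only [landmarkAlpha, stageGamma]
    field_simp
    ring
  rw [landmarkEps, h, one_div, Real.sq_sqrt (by positivity)]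

theorem landmarkEps_le_one (l k : ℕ) : landmarkEps l k ≤ 1 := by
  have h := landmarkEps_sq l k
  have h1 : ((2 : ℝ) ^ (k + 1))⁻¹ ≤ 1 := inv_le_one_of_one_le₀ (one_le_pow₀ (by norm_num))
  rw [← h] at h1
  exact (sq_le_one_iff₀ (landmarkEps_pos l k).le).1 h1

theorem stageDelta_pos (hδ : 0 < δ) (L : ℕ) : 0 < stageDelta δ (L + 1) := by
  simp only [stageDelta]; positivity

theorem stageDelta_le (hδ' : δ ≤ 1) (L : ℕ) : stageDelta δ (L + 1) ≤ 1 / 2 := by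
  have : (1 : ℝ) ≤ ((L + 1 : ℕ) : ℝ) ^ 3 := one_le_pow₀ (by exact_mod_cast Nat.le_add_left 1 L)
  rw [stageDelta, div_le_iff₀ (by positivity)]
  linarith

theorem dependsOn_stages_eq_none (L : ℕ) :
    DependsOn (fun y : ℕ → Bool × (ℕ → ℝ) => (stages δ (fun i => (y i).2) L).output = none)
      {i | i < stageStart L} := by
  induction L with
  | zero => intro y z _; simp [stages]
  | succ L ih =>
    intro y z hyz
    have h1 := ih fun i (hi : i < stageStart L) =>
      hyz i (lt_of_lt_of_le hi (stageStart_mono (Nat.le_succ L)))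
    simp only at h1
    simp only [stages_succ_eq_none_iff, h1]
    congr 1
    refine propext (forall_congr' fun k => forall_congr' fun hk => ?_)
    have h2 := dependsOn_boundedSearch_eq_none (α₀ := landmarkAlpha (L + 1) k)
      (ε₀ := landmarkEps (L + 1) k) (δ := stageDelta δ (L + 1))
      (loopStart (L + 1) (stageStart L) k) fun i hi =>
      hyz i (lt_of_lt_of_le hi.2
        (loopStart_mono (L + 1) (stageStart L) (Nat.succ_le_of_lt hk)))
    simpa [landmarkRun] using h2

theorem measurableSet_stages_eq_none (L : ℕ) :
    MeasurableSet {y : ℕ → Bool × (ℕ → ℝ) |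
      (stages δ (fun i => (y i).2) L).output = none} := by
  induction L with
  | zero => simp [stages]
  | succ L ih =>
    simp only [stages_succ_eq_none_iff]
    have : MeasurableSet {y : ℕ → Bool × (ℕ → ℝ) |
        ∀ k < L + 2, (landmarkRun δ L k fun i => (y i).2).output = none} := by
      simp only [Set.ofPred_forall]
      exact MeasurableSet.iInter fun k => MeasurableSet.iInter fun _ =>
        measurableSet_boundedSearch_eq_none _
    exact ih.inter this

/-- Survival up to stage `l` depends on the indices below `stageStart l`, the cost of the next stage
on the others, so expectations factor. -/
theorem IsBag.lintegral_totalSamples_le (h : IsBag P α θ₀ θ₁ ξ X) :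
    ∫⁻ ω, totalSamples δ (fun i j => X i j ω) ∂P ≤
      ∑' l, P {ω | (stages δ (fun i j => X i j ω) l).output = none} *
        ∑ k ∈ Finset.range (l + 2), ∫⁻ ω, (landmarkCost δ l k fun i j => X i j ω : ENNReal) ∂P := by
  classical
  have hc : ∀ l k, Measurable fun y : ℕ → Bool × (ℕ → ℝ) =>
      (landmarkCost δ l k (fun i => (y i).2) : ENNReal) := fun l k =>
    (Measurable.of_discrete (f := fun n : ℕ => (n : ENNReal))).comp (measurable_runCost _)
  have hz : ∀ l, Measurable fun y : ℕ → Bool × (ℕ → ℝ) =>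
      if (stages δ (fun i => (y i).2) l).output = none then (1 : ENNReal) else 0 := fun l =>
    Measurable.ite (measurableSet_stages_eq_none l) measurable_const measurable_const
  have hS : ∀ l, Measurable fun y : ℕ → Bool × (ℕ → ℝ) => ∑ k ∈ Finset.range (l + 2),
      (landmarkCost δ l k (fun i => (y i).2) : ENNReal) := fun l =>
    Finset.measurable_sum _ fun k _ => hc l k
  refine (lintegral_mono fun ω => totalSamples_le).trans ?_
  refine (lintegral_tsum fun l => (((hz l).comp h.measurable_draws).mul
    ((hS l).comp h.measurable_draws)).aemeasurable).trans_le ?_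
  refine ENNReal.tsum_le_tsum fun l => ?_
  have hind := indepFun_of_dependsOn (S := {i | i < stageStart l}) (T := {i | stageStart l ≤ i})
    h.iIndepFun_draw h.measurable_draw
    (by rw [Set.disjoint_left]; intro i h1 h2; simp only [Set.mem_ofPred_eq] at h1 h2; omega)
    (hz l) (hS l) (fun y z hyz => by
      have h1 := dependsOn_stages_eq_none (δ := δ) l hyz
      simp only at h1
      simp only [h1]) (fun y z hyz => by
      refine Finset.sum_congr rfl fun k _ => ?_
      have h1 := dependsOn_runCost (α₀ := landmarkAlpha (l + 1) k)
        (ε₀ := landmarkEps (l + 1) k) (δ := stageDelta δ (l + 1))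
        (loopStart (l + 1) (stageStart l) k) fun i hi =>
          hyz i (le_trans (le_loopStart _ _ _) hi)
      simp only [landmarkCost]
      exact congrArg _ h1)
  have hmul := lintegral_mul_eq_lintegral_mul_lintegral_of_indepFun
    ((hz l).comp h.measurable_draws) ((hS l).comp h.measurable_draws) hind
  refine (hmul.trans ?_).le
  congr 1
  · have hms : MeasurableSet {ω | (stages δ (fun i j => X i j ω) l).output = none} :=
      h.measurable_draws (measurableSet_stages_eq_none l)
    rw [← lintegral_indicator_one hms]
    exact lintegral_congr fun ω => by simp [Set.indicator, draw]
  · exact lintegral_finsetSum _ fun k _ => (hc l k).comp h.measurable_draws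

variable [IsProbabilityMeasure P]

theorem IsBag.measure_stages_succ_le (h : IsBag P α θ₀ θ₁ ξ X) (hα : 0 < α) (hα' : α ≤ 1 / 2)
    (hδ : 0 < δ) (hδ' : δ ≤ 1) {L k : ℕ} (hk : k < L + 2) (hαk : landmarkAlpha (L + 1) k ≤ α)
    (hεk : landmarkEps (L + 1) k ≤ θ₁ - θ₀) :
    P {ω | (stages δ (fun i j => X i j ω) (L + 1)).output = none} ≤
      P {ω | (stages δ (fun i j => X i j ω) L).output = none} * ENNReal.ofReal (1 / 4) := by
  have hS := measurableSet_stages_eq_none (δ := δ) L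
  have hR := measurableSet_boundedSearch_eq_none (α₀ := landmarkAlpha (L + 1) k)
    (ε₀ := landmarkEps (L + 1) k) (δ := stageDelta δ (L + 1))
    (loopStart (L + 1) (stageStart L) k)
  have hind := indepFun_of_dependsOn (S := {i | i < stageStart L}) (T := {i | stageStart L ≤ i})
    h.iIndepFun_draw h.measurable_draw
    (by rw [Set.disjoint_left]; intro i h1 h2; simp only [Set.mem_ofPred_eq] at h1 h2; omega)
    (measurable_mem.2 hS) (measurable_mem.2 hR) (dependsOn_stages_eq_none L)
    ((dependsOn_boundedSearch_eq_none _).mono fun i hi => le_trans (le_loopStart _ _ _) hi.1)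
  -- The two events are treated as `Prop`-valued random variables, hence the preimages of `{True}`.
  have hmul := hind.measure_inter_preimage_eq_mul {True} {True}
    (measurableSet_singleton _) (measurableSet_singleton _)
  refine (measure_mono (t := _ ∩ _) ?_).trans (hmul.le.trans ?_)
  · intro ω hω
    obtain ⟨h1, h2⟩ := (stages_succ_eq_none_iff L).1 hω
    exact ⟨eq_true h1, eq_true (h2 k hk)⟩
  · refine mul_le_mul' (measure_mono fun ω hω => of_eq_true hω) ?_
    refine le_trans (measure_mono fun ω hω => of_eq_true hω)
      (h.measure_null_le hα hα' (landmarkAlpha_pos (L + 1) k) hαk (landmarkEps_pos (L + 1) k) hεk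
        (stageDelta_pos hδ L) (stageDelta_le hδ' L) (loopStart (L + 1) (stageStart L) k))

/-- Each stage after `M` contains the sufficient landmark `K` and survives with conditional
probability at most `1 / 4`. For `L ≤ M` the truncated exponent is `0` and the bound is trivial. -/
theorem IsBag.measure_stages_le (h : IsBag P α θ₀ θ₁ ξ X) (hα : 0 < α) (hα' : α ≤ 1 / 2)
    (hδ : 0 < δ) (hδ' : δ ≤ 1) {K M : ℕ} (hKM : K ≤ M)
    (hαk : ∀ L, M ≤ L → landmarkAlpha (L + 1) K ≤ α)
    (hεk : ∀ L, landmarkEps (L + 1) K ≤ θ₁ - θ₀) (L : ℕ) :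
    P {ω | (stages δ (fun i j => X i j ω) L).output = none} ≤
      ENNReal.ofReal (1 / 4) ^ (L - M) := by
  induction L with
  | zero => simpa using prob_le_one
  | succ L ih =>
    by_cases hL : M ≤ L
    · rw [Nat.sub_add_comm hL, pow_succ]
      refine (h.measure_stages_succ_le hα hα' hδ hδ' (k := K) (by omega) (hαk L hL)
        (hεk L)).trans ?_
      gcongr
    · rw [show L + 1 - M = 0 by omega]
      simpa using prob_le_one

theorem IsBag.measure_returns_heavy_ge (h : IsBag P α θ₀ θ₁ ξ X) (hα : 0 < α) (hα' : α ≤ 1 / 2)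
    (hθ : θ₀ < θ₁) (hδ : 0 < δ) (hδ' : δ ≤ 1) {K M : ℕ} (hKM : K ≤ M)
    (hαk : ∀ L, M ≤ L → landmarkAlpha (L + 1) K ≤ α)
    (hεk : ∀ L, landmarkEps (L + 1) K ≤ θ₁ - θ₀) :
    ENNReal.ofReal (1 - δ) ≤
      P {ω | ∃ i, Returns δ (fun i j => X i j ω) i ∧ ξ i ω = true} := by
  set G := {ω | ∃ i, Returns δ (fun i j => X i j ω) i ∧ ξ i ω = true}
  let Z := {ω | ∀ L, (stages δ (fun i j => X i j ω) L).output = none}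
  have hZ : P Z = 0 := by
    have h1 : ∀ n : ℕ, P Z ≤ ENNReal.ofReal (1 / 4) ^ n := fun n => by
      have := h.measure_stages_le hα hα' hδ hδ' hKM hαk hεk (M + n)
      rw [Nat.add_sub_cancel_left] at this
      have hsub : Z ⊆ {ω | (stages δ (fun i j => X i j ω) (M + n)).output = none} :=
        fun ω hω => hω (M + n)
      exact (measure_mono hsub).trans this
    have h2 : Filter.Tendsto (fun n : ℕ => ENNReal.ofReal (1 / 4) ^ n) Filter.atTop (nhds 0) :=
      ENNReal.tendsto_pow_atTop_nhds_zero_of_lt_one (by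
        rw [ENNReal.ofReal_lt_one]; norm_num)
    exact le_antisymm (ge_of_tendsto' h2 h1) zero_le
  let F (L k : ℕ) := {ω | ∃ i, (landmarkRun δ L k fun i j => X i j ω).output = some i ∧
    ξ i ω = false}
  have hF : ∀ L k, P (F L k) ≤ ENNReal.ofReal (stageDelta δ (L + 1) / 4) := fun L k =>
    h.measure_light_output_le hα (by linarith) hθ (landmarkAlpha_pos _ _) (landmarkEps_pos _ _)
      (stageDelta_pos hδ L) ((stageDelta_le hδ' L).trans (by norm_num)) _
  have hcover : (Set.univ : Set Ω) ⊆ (G ∪ Z) ∪ ⋃ L, ⋃ k ∈ Finset.range (L + 2), F L k := by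
    intro ω _
    by_cases hω : ω ∈ Z
    · exact Or.inl (Or.inr hω)
    · simp only [Z, Set.mem_ofPred_eq, not_forall] at hω
      obtain ⟨L, hL⟩ := hω
      obtain ⟨i, hi⟩ := Option.ne_none_iff_exists'.1 hL
      by_cases hk : ξ i ω = true
      · exact Or.inl (Or.inl ⟨i, ⟨L, hi⟩, hk⟩)
      · obtain ⟨L', k, hk', h1⟩ := stages_eq_some L hi
        refine Or.inr (Set.mem_iUnion.2 ⟨L', Set.mem_biUnion (x := k) (by simpa using hk') ?_⟩)
        exact ⟨i, h1, by simpa using hk⟩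
  have hFsum : P (⋃ L, ⋃ k ∈ Finset.range (L + 2), F L k) ≤ ENNReal.ofReal δ := by
    refine (measure_iUnion_le _).trans (ENNReal.tsum_le_of_sum_range_le fun n => ?_)
    -- Stage `L + 1` has `L + 2` landmarks, each erring with probability at most `δ / (8 (L + 1)³)`;
    -- this is dominated by the telescoping term `δ / 2 * (1 / (L + 1) - 1 / (L + 2))`.
    suffices H : ∑ L ∈ Finset.range n, P (⋃ k ∈ Finset.range (L + 2), F L k) ≤
        ENNReal.ofReal (δ / 2 * (1 - 1 / (n + 1))) from
      H.trans (ENNReal.ofReal_le_ofReal (by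
        have : (0 : ℝ) < 1 / (n + 1) := by positivity
        nlinarith))
    induction n with
    | zero => simp
    | succ n ih =>
      have h0 : (0 : ℝ) ≤ 1 - 1 / (n + 1) := by
        rw [sub_nonneg, div_le_one (by positivity)]
        linarith [(n.cast_nonneg : (0 : ℝ) ≤ n)]
      have h1 : P (⋃ k ∈ Finset.range (n + 2), F n k) ≤
          ENNReal.ofReal (δ / 2 * (1 / (n + 1) - 1 / (n + 2))) := by
        refine (measure_biUnion_finset_le _ _).trans
          ((Finset.sum_le_card_nsmul _ _ _ fun k _ => hF n k).trans ?_)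
        rw [Finset.card_range, nsmul_eq_mul, ← ENNReal.ofReal_natCast,
          ← ENNReal.ofReal_mul (by positivity)]
        refine ENNReal.ofReal_le_ofReal ?_
        simp only [stageDelta]
        push_cast
        have hn : (0 : ℝ) ≤ n := n.cast_nonneg
        have e : δ / 2 * (1 / ((n : ℝ) + 1) - 1 / (n + 2)) -
            (n + 2) * (δ / (2 * (n + 1) ^ 3) / 4) =
            δ * (4 * (n + 1) ^ 2 - (n + 2) ^ 2) / (8 * (n + 1) ^ 3 * (n + 2)) := by
          field_simp
          ring
        rw [← sub_nonneg, e]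
        have : (0 : ℝ) ≤ 4 * (n + 1) ^ 2 - (n + 2) ^ 2 := by nlinarith
        positivity
      rw [Finset.sum_range_succ]
      refine (add_le_add ih h1).trans_eq ?_
      rw [← ENNReal.ofReal_add (by positivity)]
      · congr 1
        push_cast
        ring
      · refine mul_nonneg (by positivity) (sub_nonneg.2 ?_)
        gcongr
        norm_num
  -- Covering the whole space needs only subadditivity, hence no measurability of `G`.
  have h1 : (1 : ENNReal) ≤ P G + ENNReal.ofReal δ := by
    calc (1 : ENNReal) = P Set.univ := measure_univ.symm
      _ ≤ P ((G ∪ Z) ∪ ⋃ L, ⋃ k ∈ Finset.range (L + 2), F L k) := measure_mono hcover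
      _ ≤ (P G + P Z) + P (⋃ L, ⋃ k ∈ Finset.range (L + 2), F L k) :=
        (measure_union_le _ _).trans (add_le_add_left (measure_union_le _ _) _)
      _ ≤ _ := by
        rw [hZ, add_zero]
        gcongr
  rw [ENNReal.ofReal_sub _ hδ.le, ENNReal.ofReal_one]
  exact tsub_le_iff_right.2 h1

end Bag

/-! ### Cost of a landmark in terms of its stage. -/

section Cost

theorem log_le_of_le_two_pow {y : ℝ} {n : ℕ} (hy : 0 < y) (h : y ≤ 2 ^ n) : Real.log y ≤ n := by
  calc Real.log y ≤ Real.log (2 ^ n) := Real.log_le_log hy h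
    _ = n * Real.log 2 := Real.log_pow _ _
    _ ≤ n * 1 := by gcongr; linarith [Real.log_two_lt_d9]
    _ = n := mul_one _

variable {α δ : ℝ}

theorem numArms_landmark_le {l k : ℕ} (hk : k ≤ l) :
    (numArms (landmarkAlpha l k) : ℝ) ≤ 9 * 2 ^ (l - k) := by
  have h9 : Real.log 9 ≤ 4 := log_le_of_le_two_pow (n := 4) (by norm_num) (by norm_num)
  have h90 : 0 < Real.log 9 := Real.log_pos (by norm_num)
  have ha : (1 : ℝ) ≤ 2 ^ (l - k) := one_le_pow₀ (by norm_num)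
  have e : 2 * Real.log 9 / landmarkAlpha l k = 2 * Real.log 9 * 2 ^ (l - k) := by
    rw [pow_sub₀ _ two_ne_zero hk]
    simp only [landmarkAlpha, stageGamma]
    field_simp
  rw [numArms, e]
  have := Nat.ceil_lt_add_one (a := 2 * Real.log 9 * 2 ^ (l - k)) (by positivity)
  nlinarith

theorem logTerm_landmark_le (hδ : 0 < δ) {L k : ℕ} (hk : k ≤ L + 1) :
    logTerm (landmarkAlpha (L + 1) k) (stageDelta δ (L + 1)) ≤
      8 + Real.log (2 ^ (L + 1 - k)) + 3 * Real.log ((L + 1 : ℕ) : ℝ) + Real.log (1 / δ) := by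
  have hn := numArms_landmark_le hk
  have hn1 : (1 : ℝ) ≤ numArms (landmarkAlpha (L + 1) k) := by
    exact_mod_cast one_le_numArms (landmarkAlpha_pos _ _)
  have hl : (0 : ℝ) < ((L + 1 : ℕ) : ℝ) := by positivity
  have hsd := stageDelta_pos hδ L
  have h252 : Real.log 252 ≤ 8 := log_le_of_le_two_pow (n := 8) (by norm_num) (by norm_num)
  calc _ ≤ Real.log (252 * 2 ^ (L + 1 - k) * ((L + 1 : ℕ) : ℝ) ^ 3 * (1 / δ)) := by
        refine Real.log_le_log (by positivity) ?_
        rw [stageDelta, div_div_eq_mul_div, div_le_iff₀ hδ]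
        calc _ ≤ 14 * (9 * 2 ^ (L + 1 - k)) * (2 * ((L + 1 : ℕ) : ℝ) ^ 3) := by gcongr
          _ = _ := by field_simp; ring
    _ = Real.log 252 + Real.log (2 ^ (L + 1 - k)) + 3 * Real.log ((L + 1 : ℕ) : ℝ) +
        Real.log (1 / δ) := by
      rw [Real.log_mul (by positivity) (by positivity),
        Real.log_mul (by positivity) (by positivity),
        Real.log_mul (by positivity) (by positivity), Real.log_pow ((L + 1 : ℕ) : ℝ) 3]
      norm_num only
    _ ≤ _ := by linarith

theorem maxSamples_le {α₀ ε₀ : ℝ} (hα₀ : 0 < α₀) (he : 0 < ε₀) (he' : ε₀ ≤ 1) (hδ : 0 < δ)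
    (hδ' : δ ≤ 1) : (maxSamples α₀ ε₀ δ : ℝ) ≤ 65 * (ε₀ ^ 2)⁻¹ * logTerm α₀ δ := by
  have hL := one_lt_logTerm hα₀ hδ hδ'
  have hq : 1 ≤ (ε₀ ^ 2)⁻¹ := (one_le_inv₀ (by positivity)).2 (pow_le_one₀ he.le he')
  have := Nat.ceil_lt_add_one (a := 64 * (ε₀ ^ 2)⁻¹ * logTerm α₀ δ) (by positivity)
  have h2 : (maxSamples α₀ ε₀ δ : ℝ) < 64 * (ε₀ ^ 2)⁻¹ * logTerm α₀ δ + 1 := this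
  nlinarith

theorem calibrationSamples_le {α₀ ε₀ : ℝ} (hα₀ : 0 < α₀) (he : 0 < ε₀) (he' : ε₀ ≤ 1)
    (hδ : 0 < δ) (hδ' : δ ≤ 1) :
    (calibrationSamples α₀ ε₀ δ : ℝ) ≤ 9 * (ε₀ ^ 2)⁻¹ * (10 + logTerm α₀ δ) := by
  have hL := one_lt_logTerm hα₀ hδ hδ'
  have hn1 : (1 : ℝ) ≤ numArms α₀ := by exact_mod_cast one_le_numArms hα₀
  have hq : 1 ≤ (ε₀ ^ 2)⁻¹ := (one_le_inv₀ (by positivity)).2 (pow_le_one₀ he.le he')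
  have hm0 := maxSamples_pos hα₀ he hδ hδ'
  have hC0 := calibrationError_pos hα₀ he hδ hδ'
  have h650 : Real.log 650 ≤ 10 := log_le_of_le_two_pow (n := 10) (by norm_num) (by norm_num)
  -- From `m ε₀² ≤ 65 log N ≤ 65 N` with `N = 14 n / δ`, so the logarithm in `k₂` exceeds `log N` by
  -- at most a constant.
  have hE : (650 * (14 * numArms α₀ / δ))⁻¹ * 10 ≤ calibrationError α₀ ε₀ δ := by
    refine le_min ?_ ?_
    · rw [← div_eq_inv_mul, div_le_iff₀ (by positivity)]
      have : δ / 8 * (650 * (14 * numArms α₀ / δ)) = 650 * 14 / 8 * numArms α₀ := by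
        field_simp
      rw [this]
      linarith
    · rw [← div_eq_inv_mul, div_le_iff₀ (by positivity)]
      have h1 := maxSamples_le hα₀ he he' hδ hδ'
      have h2 : logTerm α₀ δ ≤ 14 * numArms α₀ / δ :=
        (Real.log_le_sub_one_of_pos (by positivity)).trans (by linarith)
      have h3 : (maxSamples α₀ ε₀ δ : ℝ) ≤ 65 * (ε₀ ^ 2)⁻¹ * (14 * numArms α₀ / δ) :=
        h1.trans (by gcongr)
      rw [mul_assoc, ← div_eq_inv_mul, le_div_iff₀ hm0]
      linarith
  have hlog : Real.log (10 / calibrationError α₀ ε₀ δ) ≤ 10 + logTerm α₀ δ := by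
    calc _ ≤ Real.log (650 * (14 * numArms α₀ / δ)) := by
          refine Real.log_le_log (by positivity) ?_
          rw [div_le_iff₀ hC0, ← div_le_iff₀' (by positivity), div_eq_inv_mul]
          exact hE
      _ = Real.log 650 + logTerm α₀ δ := Real.log_mul (by norm_num) (by positivity)
      _ ≤ _ := by linarith
  have h0 : 0 ≤ Real.log (10 / calibrationError α₀ ε₀ δ) := by
    refine Real.log_nonneg ((one_le_div hC0).2 ?_)
    have h1 : calibrationError α₀ ε₀ δ ≤ δ / 8 := min_le_left _ _
    linarith
  have h2 : (calibrationSamples α₀ ε₀ δ : ℝ) <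
      8 * (ε₀ ^ 2)⁻¹ * Real.log (10 / calibrationError α₀ ε₀ δ) + 1 := by
    refine lt_of_eq_of_lt ?_ (Nat.ceil_lt_add_one (by positivity))
    rw [calibrationSamples, calibrationError]
    norm_num
  have h3 : 8 * (ε₀ ^ 2)⁻¹ * Real.log (10 / calibrationError α₀ ε₀ δ) ≤
      8 * (ε₀ ^ 2)⁻¹ * (10 + logTerm α₀ δ) := by gcongr
  nlinarith

/-- The bound does not depend on `k`: up to constants the number of tested distributions is `2 ^ (L
+ 1 - k)` and `ε_k⁻² = 2 ^ (k + 1)`, with product `2 * 2 ^ (L + 1)`. -/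
theorem landmark_cost_le (hα : 0 < α) (hα' : α ≤ 1) (hδ : 0 < δ) (hδ' : δ ≤ 1) {L k : ℕ}
    (hk : k ≤ L + 1) :
    5 * (calibrationSamples (landmarkAlpha (L + 1) k) (landmarkEps (L + 1) k)
        (stageDelta δ (L + 1)) : ℝ) +
      numArms (landmarkAlpha (L + 1) k) * (maxSamples (landmarkAlpha (L + 1) k)
        (landmarkEps (L + 1) k) (stageDelta δ (L + 1)) * α +
          140 * (landmarkEps (L + 1) k ^ 2)⁻¹) ≤
      20000 * 2 ^ (L + 1) *
        (1 + α * ((L + 1 : ℕ) : ℝ) + Real.log ((L + 1 : ℕ) : ℝ) + Real.log (1 / δ)) := by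
  have hd0 := stageDelta_pos hδ L
  have hd1 : stageDelta δ (L + 1) ≤ 1 := (stageDelta_le hδ' L).trans (by norm_num)
  have ha0 := landmarkAlpha_pos (L + 1) k
  have he0 := landmarkEps_pos (L + 1) k
  have he1 := landmarkEps_le_one (L + 1) k
  have h1 := calibrationSamples_le ha0 he0 he1 hd0 hd1
  have h2 := maxSamples_le ha0 he0 he1 hd0 hd1
  have h3 := numArms_landmark_le hk
  have h4 := logTerm_landmark_le hδ hk
  have h5 := one_lt_logTerm ha0 hd0 hd1
  rw [landmarkEps_sq, inv_inv] at *
  set n := (numArms (landmarkAlpha (L + 1) k) : ℝ)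
  set m := (maxSamples (landmarkAlpha (L + 1) k) (landmarkEps (L + 1) k)
    (stageDelta δ (L + 1)) : ℝ)
  set c := (calibrationSamples (landmarkAlpha (L + 1) k) (landmarkEps (L + 1) k)
    (stageDelta δ (L + 1)) : ℝ)
  set Λ := logTerm (landmarkAlpha (L + 1) k) (stageDelta δ (L + 1))
  set q : ℝ := 2 ^ (k + 1)
  set a : ℝ := 2 ^ (L + 1 - k)
  set w := Real.log ((L + 1 : ℕ) : ℝ)
  set D := Real.log (1 / δ)
  have ha : 1 ≤ a := one_le_pow₀ (by norm_num)
  have hq : 0 < q := by positivity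
  have haq : a * q = 2 * 2 ^ (L + 1) := by
    simp only [a, q]
    rw [← pow_add, ← pow_succ']
    congr 1
    omega
  have hw : 0 ≤ w := Real.log_nonneg (by exact_mod_cast Nat.le_add_left 1 L)
  have hD : 0 ≤ D := Real.log_nonneg ((one_le_div hδ).2 hδ')
  have hn0 : 0 ≤ n := Nat.cast_nonneg _
  set T : ℝ := 2 ^ (L + 1)
  have hT : 0 < T := by positivity
  -- Two bounds for one logarithm. In the calibration cost, `log a ≤ a` is absorbed by `a q = 2 T`;
  -- in the heavy tests, `log a ≤ L + 1` comes with the factor `α`. So a term linear in the stage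
  -- appears only multiplied by `α`.
  have hla : Real.log a ≤ a := (Real.log_le_sub_one_of_pos (by positivity)).trans (by linarith)
  have hla' : Real.log a ≤ ((L + 1 : ℕ) : ℝ) := by
    refine (log_le_of_le_two_pow (by positivity) le_rfl).trans ?_
    exact_mod_cast Nat.sub_le _ _
  have hc : c ≤ 18 * T * (19 + 3 * w + D) := by
    have hqT : q ≤ 2 * T := by nlinarith
    calc c ≤ 9 * q * (10 + Λ) := h1
      _ ≤ 9 * q * (18 + a + 3 * w + D) :=
        mul_le_mul_of_nonneg_left (by linarith) (by positivity)
      _ = 9 * (a * q) + 9 * q * (18 + 3 * w + D) := by ring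
      _ ≤ 9 * (2 * T) + 9 * (2 * T) * (18 + 3 * w + D) := by
        rw [haq]
        gcongr
      _ = _ := by ring
  have hnm : n * (m * α) ≤ 1170 * T * (8 + α * ((L + 1 : ℕ) : ℝ) + 3 * w + D) := by
    have hΛα : Λ * α ≤ 8 + α * ((L + 1 : ℕ) : ℝ) + 3 * w + D := by
      calc Λ * α ≤ (8 + ((L + 1 : ℕ) : ℝ) + 3 * w + D) * α := by gcongr; linarith
        _ = α * ((L + 1 : ℕ) : ℝ) + (8 + 3 * w + D) * α := by ring
        _ ≤ α * ((L + 1 : ℕ) : ℝ) + (8 + 3 * w + D) * 1 := by gcongr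
        _ = _ := by ring
    calc n * (m * α) ≤ (9 * a) * ((65 * q * Λ) * α) := by gcongr
      _ = 585 * (a * q) * (Λ * α) := by ring
      _ = 1170 * T * (Λ * α) := by rw [haq]; ring
      _ ≤ _ := by gcongr
  have hnq : n * (140 * q) ≤ 2520 * T := by
    calc n * (140 * q) ≤ (9 * a) * (140 * q) := by gcongr
      _ = 1260 * (a * q) := by ring
      _ = _ := by rw [haq]; ring
  have hαL : 0 ≤ α * ((L + 1 : ℕ) : ℝ) := by positivity
  have p1 := mul_nonneg hT.le hw
  have p2 := mul_nonneg hT.le hD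
  have p3 := mul_nonneg hT.le hαL
  nlinarith

end Cost

/-! ### Summation over the stages. -/

section Sum

theorem sum_range_sq_div_two_pow (N : ℕ) :
    ∑ j ∈ Finset.range N, ((j : ℝ) + 1) ^ 2 * (1 / 2) ^ j ≤ 12 := by
  suffices H : ∑ j ∈ Finset.range N, ((j : ℝ) + 1) ^ 2 * (1 / 2) ^ j =
      12 - (2 * (N : ℝ) ^ 2 + 8 * N + 12) * (1 / 2) ^ N by
    rw [H]
    have : (0 : ℝ) ≤ (2 * (N : ℝ) ^ 2 + 8 * N + 12) * (1 / 2) ^ N := by positivity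
    linarith
  induction N with
  | zero => norm_num
  | succ N ih =>
    rw [Finset.sum_range_succ, ih, pow_succ]
    push_cast
    ring

theorem sum_range_two_pow_le (M : ℕ) :
    ∑ L ∈ Finset.range M, (2 : ℝ) ^ (L + 1) ≤ 2 * 2 ^ M := by
  induction M with
  | zero => norm_num
  | succ M ih =>
    rw [Finset.sum_range_succ, pow_succ 2 M]
    linarith

/-- The stages up to the first sufficient one dominate the expected cost. -/
theorem sum_stage_cost_le {α D : ℝ} (hα : 0 ≤ α) (hα' : α ≤ 1) (hD : 0 ≤ D) {M : ℕ} (hM : 1 ≤ M)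
    (N : ℕ) :
    ∑ L ∈ Finset.range N, (1 / 4 : ℝ) ^ (L - M) * ((L + 2) * (2 ^ (L + 1) *
      (1 + α * ((L + 1 : ℕ) : ℝ) + Real.log ((L + 1 : ℕ) : ℝ) + D))) ≤
      220 * (M * 2 ^ M) * (1 + α * M + Real.log M + D) := by
  have hM' : (1 : ℝ) ≤ M := by exact_mod_cast hM
  set G := 1 + α * M + Real.log M + D with hG
  have hlogM : 0 ≤ Real.log M := Real.log_nonneg hM'
  have hαM : 0 ≤ α * M := by positivity
  have hG1 : 1 ≤ G := by linarith
  have hlog : ∀ L : ℕ, 0 ≤ Real.log ((L + 1 : ℕ) : ℝ) := fun L =>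
    Real.log_nonneg (by exact_mod_cast Nat.le_add_left 1 L)
  -- Enlarging the range to `M + N` allows a split at `M`: before it, a geometric sum dominated by
  -- `2 ^ M`; after it, `4 ^ (-j) 2 ^ j = 2 ^ (-j)` times a quadratic factor from the number of
  -- landmarks and the growth of the bracket.
  refine (Finset.sum_le_sum_of_subset_of_nonneg (Finset.range_mono (Nat.le_add_left N M))
    fun L _ _ => ?_).trans ?_
  · have := hlog L
    positivity
  rw [Finset.sum_range_add]
  have h1 : ∑ L ∈ Finset.range M, (1 / 4 : ℝ) ^ (L - M) * ((L + 2) * (2 ^ (L + 1) *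
      (1 + α * ((L + 1 : ℕ) : ℝ) + Real.log ((L + 1 : ℕ) : ℝ) + D))) ≤
      4 * (M * 2 ^ M) * G := by
    calc _ ≤ ∑ L ∈ Finset.range M, 2 * M * G * (2 : ℝ) ^ (L + 1) := by
          refine Finset.sum_le_sum fun L hL => ?_
          have hL' := Finset.mem_range.1 hL
          have hL2 : ((L + 1 : ℕ) : ℝ) ≤ M := by exact_mod_cast hL'
          have hL3 : (L : ℝ) + 2 ≤ 2 * M := by push_cast at hL2; linarith
          rw [show L - M = 0 by omega, pow_zero, one_mul]
          calc _ ≤ (2 * M) * (2 ^ (L + 1) * G) := by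
                have := hlog L
                rw [hG]
                gcongr
            _ = _ := by ring
      _ = 2 * M * G * ∑ L ∈ Finset.range M, (2 : ℝ) ^ (L + 1) := by rw [Finset.mul_sum]
      _ ≤ 2 * M * G * (2 * 2 ^ M) := by gcongr; exact sum_range_two_pow_le M
      _ = _ := by ring
  have h2 : ∑ j ∈ Finset.range N, (1 / 4 : ℝ) ^ (M + j - M) * (((M + j : ℕ) + 2) *
      (2 ^ (M + j + 1) *
      (1 + α * ((M + j + 1 : ℕ) : ℝ) + Real.log ((M + j + 1 : ℕ) : ℝ) + D))) ≤
      216 * (M * 2 ^ M) * G := by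
    calc _ ≤ ∑ j ∈ Finset.range N, 18 * (M * 2 ^ M) * G * (((j : ℝ) + 1) ^ 2 * (1 / 2) ^ j) := by
          refine Finset.sum_le_sum fun j _ => ?_
          have hj : (0 : ℝ) ≤ j := j.cast_nonneg
          have e1 : ((M + j : ℕ) : ℝ) + 2 ≤ 3 * M * (j + 1) := by push_cast; nlinarith
          have e2 : 1 + α * ((M + j + 1 : ℕ) : ℝ) + Real.log ((M + j + 1 : ℕ) : ℝ) + D ≤
              3 * (j + 1) * G := by
            have e3 : Real.log ((M + j + 1 : ℕ) : ℝ) ≤ Real.log M + (j + 1) := by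
              calc _ ≤ Real.log (M * (j + 2)) := by
                    refine Real.log_le_log (by positivity) ?_
                    push_cast
                    nlinarith
                _ = Real.log M + Real.log (j + 2) := Real.log_mul (by positivity) (by positivity)
                _ ≤ _ := by
                  have := Real.log_le_sub_one_of_pos (show (0 : ℝ) < j + 2 by positivity)
                  linarith
            have e4 : α * ((M + j + 1 : ℕ) : ℝ) ≤ α * M + (j + 1) := by push_cast; nlinarith
            nlinarith
          have := hlog (M + j)
          calc _ ≤ (1 / 4 : ℝ) ^ j * ((3 * M * (j + 1)) * (2 ^ (M + j + 1) *
                (3 * (j + 1) * G))) := by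
                rw [Nat.add_sub_cancel_left]
                gcongr
            _ = _ := by
              rw [show (1 / 4 : ℝ) = 1 / 2 * (1 / 2) by norm_num, mul_pow, pow_succ, pow_add]
              have : (2 : ℝ) ^ j * (1 / 2) ^ j = 1 := by rw [← mul_pow]; norm_num
              linear_combination
                (18 * M * 2 ^ M * G * (j + 1) ^ 2 * (1 / 2 : ℝ) ^ j) * this
      _ = 18 * (M * 2 ^ M) * G * ∑ j ∈ Finset.range N, (((j : ℝ) + 1) ^ 2 * (1 / 2) ^ j) := by
        rw [Finset.mul_sum]
      _ ≤ 18 * (M * 2 ^ M) * G * 12 := by gcongr; exact sum_range_sq_div_two_pow N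
      _ = _ := by ring
  refine (add_le_add h1 h2).trans_eq ?_
  ring

end Sum

/-! ### The sufficient landmark and the final bound. -/

section Main

variable {Ω : Type*} [MeasurableSpace Ω] {P : Measure Ω} [IsProbabilityMeasure P]
  {α θ₀ θ₁ δ : ℝ} {ξ : ℕ → Ω → Bool} {X : ℕ → ℕ → Ω → ℝ}

theorem IsBag.lintegral_totalSamples_le_of_landmark (h : IsBag P α θ₀ θ₁ ξ X) (hα : 0 < α)
    (hα' : α ≤ 1 / 2) (hθ : θ₀ < θ₁) (hθ₁ : θ₁ ≤ 1) (hδ : 0 < δ) (hδ' : δ ≤ 1) {K M : ℕ}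
    (hKM : K ≤ M) (hM : 1 ≤ M) (hαk : ∀ L, M ≤ L → landmarkAlpha (L + 1) K ≤ α)
    (hεk : ∀ L, landmarkEps (L + 1) K ≤ θ₁ - θ₀) :
    ∫⁻ ω, totalSamples δ (fun i j => X i j ω) ∂P ≤
      ENNReal.ofReal (20000 * (220 * (M * 2 ^ M) * (1 + α * M + Real.log M + Real.log (1 / δ)))) := by
  have hD : 0 ≤ Real.log (1 / δ) := Real.log_nonneg ((one_le_div hδ).2 hδ')
  refine h.lintegral_totalSamples_le.trans (ENNReal.tsum_le_of_sum_range_le fun N => ?_)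
  refine le_trans ?_ (ENNReal.ofReal_le_ofReal (mul_le_mul_of_nonneg_left
    (sum_stage_cost_le hα.le (by linarith) hD hM N) (by norm_num)))
  rw [Finset.mul_sum, ENNReal.ofReal_sum_of_nonneg]
  · refine Finset.sum_le_sum fun L _ => ?_
    have hlog : 0 ≤ Real.log ((L + 1 : ℕ) : ℝ) :=
      Real.log_nonneg (by exact_mod_cast Nat.le_add_left 1 L)
    refine (mul_le_mul' (h.measure_stages_le hα hα' hδ hδ' hKM hαk hεk L)
      (Finset.sum_le_card_nsmul _ _ (ENNReal.ofReal (20000 * 2 ^ (L + 1) *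
        (1 + α * ((L + 1 : ℕ) : ℝ) + Real.log ((L + 1 : ℕ) : ℝ) + Real.log (1 / δ))))
        fun k hk => ?_)).trans_eq ?_
    · refine (h.lintegral_runCost_le hα (by linarith) hθ hθ₁ (landmarkAlpha_pos _ _)
        (landmarkEps_pos _ _) (landmarkEps_le_one _ _) (stageDelta_pos hδ L)
        ((stageDelta_le hδ' L).trans (by norm_num)) _).trans (ENNReal.ofReal_le_ofReal ?_)
      exact landmark_cost_le hα (by linarith) hδ hδ' (by have := Finset.mem_range.1 hk; omega)
    · rw [Finset.card_range, nsmul_eq_mul, ← ENNReal.ofReal_natCast,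
        ← ENNReal.ofReal_pow (by norm_num), ← ENNReal.ofReal_mul (by positivity),
        ← ENNReal.ofReal_mul (by positivity)]
      congr 1
      push_cast
      ring
  · intro L _
    have hlog : 0 ≤ Real.log ((L + 1 : ℕ) : ℝ) :=
      Real.log_nonneg (by exact_mod_cast Nat.le_add_left 1 L)
    positivity

/-- A landmark that suffices from stage `M + 1` on, with `2 ^ M ≤ 1 / (α ε²)`. -/
theorem exists_sufficient_landmark {ε : ℝ} (hα : 0 < α) (hα' : α ≤ 1 / 2) (hε : 0 < ε)
    (hε' : ε ≤ 1) : ∃ K J : ℕ, 1 ≤ J ∧ (2 : ℝ) ^ K ≤ 1 / ε ^ 2 ∧ (2 : ℝ) ^ J ≤ 1 / α ∧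
      (∀ L, K + J ≤ L → landmarkAlpha (L + 1) K ≤ α) ∧ ∀ L, landmarkEps (L + 1) K ≤ ε := by
  have h1 : 1 ≤ 1 / ε ^ 2 := (one_le_div (by positivity)).2 (pow_le_one₀ hε.le hε')
  have h2 : 2 ≤ 1 / α := by rw [le_div_iff₀ hα]; linarith
  -- `K` and `J` are the integer parts of `log₂ (1 / ε²)` and `log₂ (1 / α)`. The upper halves `1 /
  -- ε² < 2 ^ (K + 1)` and `1 / α < 2 ^ (J + 1)` make the landmark sufficient; the lower halves
  -- bound the cost.
  obtain ⟨K, hK, hK'⟩ := exists_nat_pow_near h1 one_lt_two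
  obtain ⟨J, hJ, hJ'⟩ := exists_nat_pow_near (by linarith : 1 ≤ 1 / α) one_lt_two
  refine ⟨K, J, ?_, hK, hJ, fun L hL => ?_, fun L => ?_⟩
  · rcases Nat.eq_zero_or_pos J with rfl | h
    · norm_num at hJ'
      norm_num at h2
      linarith
    · exact h
  · simp only [landmarkAlpha, stageGamma]
    rw [div_le_iff₀ (by positivity)]
    rw [div_lt_iff₀ hα] at hJ'
    calc (2 : ℝ) ^ K ≤ 2 ^ K * (2 ^ (J + 1) * α) :=
          le_mul_of_one_le_right (by positivity) hJ'.le
      _ = α * 2 ^ (K + (J + 1)) := by rw [pow_add]; ring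
      _ ≤ α * 2 ^ (L + 1) :=
          mul_le_mul_of_nonneg_left (pow_le_pow_right₀ one_le_two (by omega)) hα.le
  · refine (sq_le_sq₀ (landmarkEps_pos _ _).le hε.le).1 ?_
    rw [landmarkEps_sq, inv_le_comm₀ (by positivity) (by positivity), ← one_div]
    exact hK'.le

end Main

end

end MostBiasedCoin

theorem mainTheorem1 :
    ∃ c : ℝ, 0 < c ∧
      ∀ (Ω : Type*) [MeasurableSpace Ω] (P : MeasureTheory.Measure Ω)
        [MeasureTheory.IsProbabilityMeasure P] (α θ₀ θ₁ ε δ : ℝ)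
        (ξ : ℕ → Ω → Bool) (X : ℕ → ℕ → Ω → ℝ),
        0 < α → α ≤ 1 / 2 → 0 ≤ θ₀ → θ₀ < θ₁ → θ₁ ≤ 1 → ε = θ₁ - θ₀ → 0 < δ → δ < 1 →
        MostBiasedCoin.IsBag P α θ₀ θ₁ ξ X →
        ENNReal.ofReal (1 - δ) ≤
            P {ω | ∃ h, MostBiasedCoin.Returns δ (fun i j => X i j ω) h ∧ ξ h ω = true} ∧
        ∫⁻ ω, MostBiasedCoin.totalSamples δ (fun i j => X i j ω) ∂P ≤
            ENNReal.ofReal (c * (Real.logb 2 (1 / (α * ε ^ 2)) / (α * ε ^ 2)) *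
              (α * Real.logb 2 (1 / ε ^ 2) + Real.log (Real.logb 2 (1 / (α * ε ^ 2))) +
                Real.log (2 / δ))) ∧
        (δ ≤ 1 / 2 →
          ∫⁻ ω, MostBiasedCoin.totalSamples δ (fun i j => X i j ω) ∂P ≤
            ENNReal.ofReal (c * (Real.logb 2 (1 / (α * ε ^ 2)) / (α * ε ^ 2)) *
              (α * Real.logb 2 (1 / ε ^ 2) + Real.log (Real.logb 2 (1 / (α * ε ^ 2))) +
                Real.log (1 / δ)))) := by
  refine ⟨30000000, by norm_num, ?_⟩
  intro Ω _ P _ α θ₀ θ₁ ε δ ξ X hα hα' hθ₀ hθ hθ₁ hε hδ hδ' h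
  have hε0 : 0 < ε := by linarith
  have hε1 : ε ≤ 1 := by linarith
  obtain ⟨K, J, hJ1, hK, hJ, hαk, hεk⟩ :=
    MostBiasedCoin.exists_sufficient_landmark hα hα' hε0 hε1
  rw [hε] at hεk
  set l := Real.logb 2 (1 / (α * ε ^ 2)) with hl
  set u := Real.logb 2 (1 / ε ^ 2) with hu
  have hKu : (K : ℝ) ≤ u := by
    rw [hu, Real.le_logb_iff_rpow_le one_lt_two (by positivity), Real.rpow_natCast]
    exact hK
  have hpow : (2 : ℝ) ^ (K + J) ≤ 1 / (α * ε ^ 2) := by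
    calc (2 : ℝ) ^ (K + J) = 2 ^ K * 2 ^ J := pow_add _ _ _
      _ ≤ 1 / ε ^ 2 * (1 / α) := by gcongr
      _ = _ := by field_simp
  have hMl : ((K + J : ℕ) : ℝ) ≤ l := by
    rw [hl, Real.le_logb_iff_rpow_le one_lt_two (by positivity), Real.rpow_natCast]
    exact hpow
  have hM1 : (1 : ℝ) ≤ ((K + J : ℕ) : ℝ) := by exact_mod_cast (by omega : 1 ≤ K + J)
  have hl1 : 1 ≤ l := hM1.trans hMl
  -- The part of `α M` due to `log (1 / α)` is bounded, which is why only `α log₂ (1 / ε²)` survives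
  -- in the theorem.
  have hαJ : α * J ≤ 1 := by
    have h1 : (J : ℝ) ≤ 2 ^ J := by exact_mod_cast Nat.lt_two_pow_self.le
    rw [le_div_iff₀ hα] at hJ
    nlinarith
  have hlogl : 0 ≤ Real.log l := Real.log_nonneg hl1
  have hD : 0 ≤ Real.log (1 / δ) := Real.log_nonneg ((one_le_div hδ).2 hδ'.le)
  have hu0 : 0 ≤ u := K.cast_nonneg.trans hKu
  have hαu : 0 ≤ α * u := by positivity
  have h2δ : Real.log (2 / δ) = Real.log 2 + Real.log (1 / δ) := by
    rw [← Real.log_mul (by norm_num) (by positivity)]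
    congr 1
    ring
  have hlog2 := Real.log_two_gt_d9
  -- The additive constant `2` is absorbed by `3 log 2 > 2`; this is where `log (2 / δ)` is needed
  -- in place of `log (1 / δ)`.
  have hG : 1 + α * ((K + J : ℕ) : ℝ) + Real.log ((K + J : ℕ) : ℝ) + Real.log (1 / δ) ≤
      3 * (α * u + Real.log l + Real.log (2 / δ)) := by
    have h1 : Real.log ((K + J : ℕ) : ℝ) ≤ Real.log l := Real.log_le_log (by linarith) hMl
    have h2 : α * ((K + J : ℕ) : ℝ) ≤ α * u + 1 := by
      push_cast
      have : α * K ≤ α * u := by gcongr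
      linarith
    linarith
  have hcost := h.lintegral_totalSamples_le_of_landmark hα hα' hθ hθ₁ hδ hδ'.le
    (Nat.le_add_right K J) (by omega) hαk hεk
  have hx : 0 ≤ l / (α * ε ^ 2) := by positivity
  have hMx : ((K + J : ℕ) : ℝ) * 2 ^ (K + J) ≤ l / (α * ε ^ 2) := by
    rw [div_eq_mul_one_div]
    gcongr
  have hH : 0 ≤ α * u + Real.log l + Real.log (2 / δ) := by linarith
  have hreal : 20000 * (220 * (((K + J : ℕ) : ℝ) * 2 ^ (K + J)) * (1 + α * ((K + J : ℕ) : ℝ) +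
      Real.log ((K + J : ℕ) : ℝ) + Real.log (1 / δ))) ≤
      15000000 * (l / (α * ε ^ 2)) * (α * u + Real.log l + Real.log (2 / δ)) := by
    calc _ ≤ 20000 * (220 * (l / (α * ε ^ 2)) *
          (3 * (α * u + Real.log l + Real.log (2 / δ)))) := by
          gcongr
      _ = 13200000 * ((l / (α * ε ^ 2)) * (α * u + Real.log l + Real.log (2 / δ))) := by ring
      _ ≤ 15000000 * ((l / (α * ε ^ 2)) * (α * u + Real.log l + Real.log (2 / δ))) := by
        gcongr
        norm_num
      _ = _ := by ring
  refine ⟨h.measure_returns_heavy_ge hα hα' hθ hδ hδ'.le (Nat.le_add_right K J) hαk hεk, ?_, ?_⟩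
  · refine hcost.trans (ENNReal.ofReal_le_ofReal (hreal.trans ?_))
    gcongr
    norm_num
  · intro hδ2
    refine hcost.trans (ENNReal.ofReal_le_ofReal (hreal.trans ?_))
    -- For `δ ≤ 1 / 2` this gives `log (2 / δ) ≤ 2 log (1 / δ)`, at the cost of doubling the
    -- constant.
    have h2 : Real.log 2 ≤ Real.log (1 / δ) := by
      refine Real.log_le_log (by norm_num) ?_
      rw [le_div_iff₀ hδ]
      linarith
    calc _ ≤ 15000000 * (l / (α * ε ^ 2)) * (2 * (α * u + Real.log l + Real.log (1 / δ))) := by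
          gcongr
          linarith
      _ = _ := by ring
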